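/- Let $E$ and $E_*$ be separable complex Hilbert spaces, let $\mathbb{D}=\{z\in\mathbb{C}:|z|<1\}$, and let $F$ be a bounded analytic function on $\mathbb{D}$ whose values are bounded linear operators from $E_*$ to $E$. Suppose that for some $\delta>0$ $$\|F(z)e\|\ge\delta\|e\|\qquad\text{for all } z\in\mathbb{D}\text{ and all } e\in(\ker F(z))^\perp,$$ and that $\dim\operatorname{Ran}F(z)<\infty$ for every $z\in\mathbb{D}$. Let $\Pi_R(z)$ and $\Pi_K(z)$ be the orthogonal projections onto $\operatorname{Ran}F(z)\subset E$ and onto $\ker F(z)\subset E_*$, respectively. Write $\partial=\frac12\left(\frac{\partial}{\partial x}-i\frac{\partial}{\partial y}\right)$ and $\Delta=\frac14\left(\frac{\partial^2}{\partial x^2}+\frac{\partial^2}{\partial y^2}\right)$. Then each of $\Pi=\Pi_R$ and $\Pi=\Pi_K$ is a $C^2$ function on $\mathbb{D}$ (in the operator norm) with the following properties. 1. There is a constant $C$ such that $\|\partial\Pi(z)\|\le C/(1-|z|)$ for all $z\in\mathbb{D}$. 2. The measure $\mu$ given by $d\mu=\|\partial\Pi(z)\|^2(1-|z|)\,dx\,dy$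 on $\mathbb{D}$ is a Carleson measure, that is, there is a constant $C$ such that $\mu(\{z\in\mathbb{D}:|z-\zeta|<r\})\le Cr$ for all $\zeta$ with $|\zeta|=1$ and all $r>0$. 3. There is a bounded non-negative subharmonic $C^2$ function $\varphi$ on $\mathbb{D}$ such that $\Delta\varphi(z)\ge\|\partial\Pi(z)\|^2$ for all $z\in\mathbb{D}$. -/

import Mathlib

open Metric MeasureTheory

namespace CoronaProj

noncomputable section

/-- The open unit disk of the complex plane. -/
def unitDisk : Set ℂ := ball (0 : ℂ) 1

/-- The operator Hardy class: bounded analytic functions on the unit disk whose values are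
bounded operators from `E₁` to `E₂` (analytic with respect to the operator norm). -/
def IsHInfty {E₁ E₂ : Type*} [NormedAddCommGroup E₁] [InnerProductSpace ℂ E₁]
    [NormedAddCommGroup E₂] [InnerProductSpace ℂ E₂] (F : ℂ → E₁ →L[ℂ] E₂) : Prop :=
  DifferentiableOn ℂ F unitDisk ∧ ∃ M : ℝ, ∀ z ∈ unitDisk, ‖F z‖ ≤ M

/-- The orthogonal projection onto the range of `A`. It is defined for every bounded operator as
the projection onto the closure of the range, which is the range itself when that is
finite-dimensional (see `range_rangeProj`). -/
def rangeProj {E₁ E₂ : Type*} [NormedAddCommGroup E₁] [InnerProductSpace ℂ E₁]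
    [NormedAddCommGroup E₂] [InnerProductSpace ℂ E₂] [CompleteSpace E₂]
    (A : E₁ →L[ℂ] E₂) : E₂ →L[ℂ] E₂ :=
  (LinearMap.range A.toLinearMap).topologicalClosure.starProjection

/-- The orthogonal projection onto the kernel of `A`. -/
def kerProj {E₁ E₂ : Type*} [NormedAddCommGroup E₁] [InnerProductSpace ℂ E₁] [CompleteSpace E₁]
    [NormedAddCommGroup E₂] [InnerProductSpace ℂ E₂]
    (A : E₁ →L[ℂ] E₂) : E₁ →L[ℂ] E₁ :=
  (LinearMap.ker A.toLinearMap).topologicalClosure.starProjection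

theorem range_rangeProj {E₁ E₂ : Type*} [NormedAddCommGroup E₁] [InnerProductSpace ℂ E₁]
    [NormedAddCommGroup E₂] [InnerProductSpace ℂ E₂] [CompleteSpace E₂]
    (A : E₁ →L[ℂ] E₂) [FiniteDimensional ℂ (LinearMap.range A.toLinearMap)] :
    LinearMap.range (rangeProj A).toLinearMap = LinearMap.range A.toLinearMap := by
  have h : (LinearMap.range A.toLinearMap).topologicalClosure = LinearMap.range A.toLinearMap :=
    (Submodule.closed_of_finiteDimensional _).submodule_topologicalClosure_eq
  rw [rangeProj, Submodule.range_starProjection, h]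

theorem range_kerProj {E₁ E₂ : Type*} [NormedAddCommGroup E₁] [InnerProductSpace ℂ E₁]
    [CompleteSpace E₁] [NormedAddCommGroup E₂] [InnerProductSpace ℂ E₂]
    (A : E₁ →L[ℂ] E₂) :
    LinearMap.range (kerProj A).toLinearMap = LinearMap.ker A.toLinearMap := by
  rw [kerProj, Submodule.range_starProjection]
  exact A.isClosed_ker.submodule_topologicalClosure_eq

/-- The operator `∂ = (1/2) (∂/∂x - i ∂/∂y)`. -/
def dz {V : Type*} [NormedAddCommGroup V] [NormedSpace ℂ V] (f : ℂ → V) (z : ℂ) : V :=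
  (1 / 2 : ℂ) • (fderiv ℝ f z 1 - Complex.I • fderiv ℝ f z Complex.I)

/-- The normalized Laplacian `(1/4) (∂²/∂x² + ∂²/∂y²)`. -/
def normLaplacian (φ : ℂ → ℝ) (z : ℂ) : ℝ :=
  (1 / 4) * Laplacian.laplacian φ z

/-- A real-valued function on the unit disk is subharmonic if it is upper semicontinuous and its
value at the centre of every closed disk contained in the unit disk is at most its average over
the bounding circle. -/
def IsSubharmonicOnDisk (φ : ℂ → ℝ) : Prop :=
  UpperSemicontinuousOn φ unitDisk ∧
    ∀ c : ℂ, ∀ r : ℝ, 0 < r → closedBall c r ⊆ unitDisk → φ c ≤ Real.circleAverage φ c r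

/-- A Carleson measure on the unit disk: the part of the disk at distance less than `r` from a
boundary point has measure at most a constant times `r`. -/
def IsCarleson (μ : Measure ℂ) : Prop :=
  ∃ C : ℝ, ∀ ζ : ℂ, ‖ζ‖ = 1 → ∀ r : ℝ, 0 < r →
    μ (unitDisk ∩ ball ζ r) ≤ ENNReal.ofReal (C * r)

/-- There is a bounded non-negative subharmonic (and `C²`, so that its Laplacian makes sense
pointwise) function `φ` on the disk with `Δ φ ≥ ‖∂Π‖²`. -/
def HasBoundedPotential {E : Type*} [NormedAddCommGroup E] [InnerProductSpace ℂ E]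
    (P : ℂ → E →L[ℂ] E) : Prop :=
  ∃ φ : ℂ → ℝ, ContDiffOn ℝ 2 φ unitDisk ∧ IsSubharmonicOnDisk φ ∧
    (∃ K : ℝ, ∀ z ∈ unitDisk, 0 ≤ φ z ∧ φ z ≤ K) ∧
    ∀ z ∈ unitDisk, ‖dz P z‖ ^ 2 ≤ normLaplacian φ z

/-- The bound `‖∂Π(z)‖ ≤ C / (1 - |z|)` on the disk. -/
def HasGradientBound {E : Type*} [NormedAddCommGroup E] [InnerProductSpace ℂ E]
    (P : ℂ → E →L[ℂ] E) : Prop :=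
  ∃ C : ℝ, ∀ z ∈ unitDisk, ‖dz P z‖ ≤ C / (1 - ‖z‖)

/-- The measure `‖∂Π(z)‖² (1 - |z|) dx dy` on the disk is a Carleson measure. -/
def HasCarlesonGradient {E : Type*} [NormedAddCommGroup E] [InnerProductSpace ℂ E]
    (P : ℂ → E →L[ℂ] E) : Prop :=
  IsCarleson ((volume.restrict unitDisk).withDensity
    fun z => ENNReal.ofReal (‖dz P z‖ ^ 2 * (1 - ‖z‖)))

end

end CoronaProj

/-!
The proof rests on the scalar function `φ = δ⁻² ‖F‖²`, where `‖F(z)‖` is the Hilbert–Schmidt norm.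

*The rank is constant.* If two operators are bounded below by `δ` off their kernels and differ by
less than `δ` in norm, each is injective on the orthogonal complement of the kernel of the other,
so they have equal rank (`BoundedBelow.finrank_range_le`). Hence `F` has constant rank `r` on the
disk, and `‖F(z)‖² ≤ r sup ‖F‖²` in the Hilbert–Schmidt norm (`sum_norm_apply_sq_le`).

*The potential.* With an orthonormal basis `b` of the domain, `g(z) = (F(z) bᵢ)ᵢ` is a bounded
holomorphic function with values in an `ℓ²` sum (`exists_hilbertSchmidt_lift`), and
`Δ ‖g‖² = ‖g'‖² ≥ ‖F'‖²` (`normLaplacian_norm_sq`, `opNorm_le_norm_of_apply_eq`); the function `‖g‖²`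
is subharmonic by the mean value property.

*The gradient.* Differentiating `Π F = F` and `F Π = 0` respectively, together with `Π² = Π = Π*`,
gives `δ ‖∂Π‖ ≤ ‖F'‖` for both projections (`norm_dz_rangeProj_le`, `norm_dz_kerProj_le`). So `∂Π` is
dominated by the derivative of the bounded holomorphic function `δ⁻¹ g`. The pointwise bound is then
the Schwarz lemma and the potential is `‖δ⁻¹ g‖²`. The Carleson condition
(`setLIntegral_norm_deriv_sq_le`) is the Littlewood–Paley inequality
`∫ ‖g'‖² (1 - |z|²) ≤ π sup ‖g‖²`, proved with Taylor coefficients and applied to the composition of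
`g` with disk automorphisms.

*Smoothness.* Near a point `c` the range of `F(z)` is the image of the fixed finite-dimensional space
`N = (ker F(c))ᗮ`, so `Π_R = B (B† B)⁻¹ B†` with `B` the restriction of `F(z)` to `N`
(`contDiffOn_rangeProj`). The kernel projection is one minus the range projection of the adjoint.
-/

namespace CoronaProj

open scoped ENNReal Topology ComplexConjugate InnerProduct

theorem isOpen_unitDisk : IsOpen unitDisk := isOpen_ball

theorem mem_unitDisk {z : ℂ} : z ∈ unitDisk ↔ ‖z‖ < 1 := by simp [unitDisk]

/-! ### The squared norm of a holomorphic function with values in a Hilbert space -/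

section NormSq

variable {H : Type*} [NormedAddCommGroup H] [InnerProductSpace ℂ H]

theorem contDiffOn_norm_sq [CompleteSpace H] {g : ℂ → H} (hg : DifferentiableOn ℂ g unitDisk) :
    ContDiffOn ℝ 2 (fun z => ‖g z‖ ^ 2) unitDisk :=
  ((hg.contDiffOn isOpen_unitDisk).restrict_scalars ℝ).norm_sq ℂ

theorem upperSemicontinuousOn_norm_sq {g : ℂ → H} (hg : DifferentiableOn ℂ g unitDisk) :
    UpperSemicontinuousOn (fun z => ‖g z‖ ^ 2) unitDisk :=
  (hg.continuousOn.norm.pow 2).upperSemicontinuousOn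

/-- The sub-mean value property follows from the pointwise inequality
`2 Re ⟪g c, g w⟫ - ‖g c‖ ^ 2 ≤ ‖g w‖ ^ 2`, whose left-hand side is harmonic in `w`. -/
theorem isSubharmonicOnDisk_norm_sq [CompleteSpace H]
    {g : ℂ → H} (hg : DifferentiableOn ℂ g unitDisk) :
    IsSubharmonicOnDisk (fun z => ‖g z‖ ^ 2) := by
  refine ⟨upperSemicontinuousOn_norm_sq hg, fun c r hr hcr => ?_⟩
  have hgc : ContinuousOn g (sphere c |r|) := by
    rw [abs_of_pos hr]
    exact hg.continuousOn.mono (sphere_subset_closedBall.trans hcr)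
  have hmean : Real.circleAverage g c r = g c := by
    refine DiffContOnCl.circleAverage (DifferentiableOn.diffContOnCl ?_)
    rw [abs_of_pos hr]
    exact hg.mono (closure_ball_subset_closedBall.trans hcr)
  -- the real-linear functional `2 Re ⟪g c, ·⟫`
  let L : H →L[ℝ] ℝ := (2 : ℝ) • Complex.reCLM.comp ((innerSL ℂ (g c)).restrictScalars ℝ)
  have hL : ∀ x, L x = 2 * (inner ℂ (g c) x).re := fun x => by simp [L]
  have hLc : L (g c) = 2 * ‖g c‖ ^ 2 := by
    rw [hL, inner_self_eq_norm_sq_to_K]; norm_cast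
  have hint : CircleIntegrable g c r := hgc.circleIntegrable'
  have hintL : CircleIntegrable (L ∘ g) c r :=
    ContinuousOn.circleIntegrable' (L.continuous.comp_continuousOn hgc)
  have h1 : Real.circleAverage (fun w => L (g w) - ‖g c‖ ^ 2) c r = ‖g c‖ ^ 2 := by
    have := L.circleAverage_comp_comm hint
    rw [hmean, hLc] at this
    change Real.circleAverage (fun w => (L ∘ g) w - ‖g c‖ ^ 2) c r = _
    rw [Real.circleAverage_fun_sub hintL (circleIntegrable_const _ _ _),
      Real.circleAverage_const, this]
    ring
  change ‖g c‖ ^ 2 ≤ _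
  rw [← h1]
  refine Real.circleAverage_mono
    (hintL.sub (circleIntegrable_const _ _ _))
    (ContinuousOn.circleIntegrable' (hgc.norm.pow 2)) fun w _ => ?_
  have := @norm_sub_sq ℂ H _ _ _ (g w) (g c)
  rw [← inner_conj_symm, RCLike.conj_re] at this
  rw [hL]
  simp only [RCLike.re_to_complex] at this
  nlinarith [sq_nonneg ‖g w - g c‖]

/-- `Δ ‖g‖ ^ 2 = ‖g'‖ ^ 2`: in `∂²/∂x² + ∂²/∂y²` the terms with `g''` cancel because
`1 + I² = 0`. -/
theorem normLaplacian_norm_sq [CompleteSpace H]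
    {g : ℂ → H} (hg : DifferentiableOn ℂ g unitDisk) {z : ℂ}
    (hz : z ∈ unitDisk) : normLaplacian (fun w => ‖g w‖ ^ 2) z = ‖deriv g z‖ ^ 2 := by
  have hd : ∀ w ∈ unitDisk, HasDerivAt g (deriv g w) w := fun w hw =>
    (hg.differentiableAt (isOpen_unitDisk.mem_nhds hw)).hasDerivAt
  have hd' : HasDerivAt (deriv g) (deriv (deriv g) z) z :=
    ((hg.deriv isOpen_unitDisk).differentiableAt (isOpen_unitDisk.mem_nhds hz)).hasDerivAt
  have hfun : (fun w => ‖g w‖ ^ 2) = fun w => Complex.reCLM (inner ℂ (g w) (g w)) := by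
    funext w
    exact (inner_self_eq_norm_sq (𝕜 := ℂ) (g w)).symm
  have h1 : ∀ w ∈ unitDisk, ∀ v : ℂ, fderiv ℝ (fun w => ‖g w‖ ^ 2) w v =
      2 * (inner ℂ (g w) (v • deriv g w)).re := by
    intro w hw v
    have hr : HasFDerivAt g _ w := (hd w hw).hasFDerivAt.restrictScalars ℝ
    have hF : HasFDerivAt (fun w => Complex.reCLM (inner ℂ (g w) (g w))) _ w :=
      Complex.reCLM.hasFDerivAt.comp w (hr.inner ℂ hr)
    rw [hfun, hF.fderiv]
    have : (inner ℂ (v • deriv g w) (g w)).re = (inner ℂ (g w) (v • deriv g w)).re := by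
      rw [← inner_conj_symm, Complex.conj_re]
    change (inner ℂ (g w) (v • deriv g w) + inner ℂ (v • deriv g w) (g w)).re = _
    rw [Complex.add_re, this]
    ring
  have h2 : ∀ v : ℂ, iteratedFDeriv ℝ 2 (fun w => ‖g w‖ ^ 2) z ![v, v] =
      2 * (‖v • deriv g z‖ ^ 2 + (inner ℂ (g z) ((v ^ 2) • deriv (deriv g) z)).re) := by
    intro v
    have hcd : ContDiffAt ℝ 2 (fun z => ‖g z‖ ^ 2) z :=
      (contDiffOn_norm_sq hg).contDiffAt (isOpen_unitDisk.mem_nhds hz)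
    have hdd : DifferentiableAt ℝ (fderiv ℝ (fun z => ‖g z‖ ^ 2)) z :=
      (hcd.fderiv_right (m := 1) (by norm_num)).differentiableAt (by norm_num)
    rw [iteratedFDeriv_two_apply]
    simp only [Matrix.cons_val_zero, Matrix.cons_val_one]
    have e1 : fderiv ℝ (fderiv ℝ fun w => ‖g w‖ ^ 2) z v v =
        fderiv ℝ (fun w => fderiv ℝ (fun w => ‖g w‖ ^ 2) w v) z v := by
      rw [fderiv_clm_apply hdd (differentiableAt_const v)]
      simp
    rw [e1]
    have e2 : (fun w => fderiv ℝ (fun w => ‖g w‖ ^ 2) w v) =ᶠ[𝓝 z]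
        fun w => ((2 : ℝ) • Complex.reCLM) (inner ℂ (g w) (v • deriv g w)) := by
      filter_upwards [isOpen_unitDisk.mem_nhds hz] with w hw
      rw [h1 w hw]; simp
    rw [e2.fderiv_eq]
    have hr : HasFDerivAt g _ z := (hd z hz).hasFDerivAt.restrictScalars ℝ
    have hr' : HasFDerivAt (fun w => v • deriv g w) _ z :=
      (hd'.const_smul v).hasFDerivAt.restrictScalars ℝ
    have hF : HasFDerivAt
        (fun w => ((2 : ℝ) • Complex.reCLM) (inner ℂ (g w) (v • deriv g w))) _ z :=
      ((2 : ℝ) • Complex.reCLM).hasFDerivAt.comp z (hr.inner ℂ hr')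
    rw [hF.fderiv]
    have h3 := inner_self_eq_norm_sq (𝕜 := ℂ) (v • deriv g z)
    simp only [RCLike.re_to_complex] at h3
    rw [← h3, pow_two v, mul_smul]
    change 2 * (inner ℂ (g z) (v • v • deriv (deriv g) z) +
      inner ℂ (v • deriv g z) (v • deriv g z)).re = _
    rw [Complex.add_re, add_comm]
  rw [normLaplacian, InnerProductSpace.laplacian_eq_iteratedFDeriv_complexPlane]
  simp only [h2, one_smul, one_pow, Complex.I_sq, neg_smul, inner_neg_right, Complex.neg_re,
    norm_smul, Complex.norm_I, one_mul]
  ring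

end NormSq

/-! ### Holomorphic functions with values in an `ℓ²` sum -/

section Coordinates

variable {ι E : Type*} [NormedAddCommGroup E] [InnerProductSpace ℂ E]

/-- The finite truncations of `g` are holomorphic and uniformly bounded, hence locally Lipschitz
with a common constant by the Schwarz lemma; this passes to the limit. -/
theorem continuousOn_of_coord {g : ℂ → lp (fun _ : ι => E) 2} {C : ℝ}
    (hC : ∀ z ∈ unitDisk, ‖g z‖ ≤ C)
    (hg : ∀ i, DifferentiableOn ℂ (fun z => g z i) unitDisk) : ContinuousOn g unitDisk := by
  classical
  intro c hc
  obtain ⟨R, hR, hRD⟩ := Metric.isOpen_iff.1 isOpen_unitDisk c hc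
  have hb : ∀ z ∈ ball c R, dist (g z) (g c) ≤ (2 * C) / R * dist z c := by
    intro z hz
    have hlim : ∀ w, Filter.Tendsto (fun s : Finset ι => ∑ i ∈ s, lp.single 2 i (g w i))
        Filter.atTop (𝓝 (g w)) := fun w => lp.hasSum_single (by simp) (g w)
    refine le_of_tendsto ((hlim z).dist (hlim c)) (Filter.Eventually.of_forall fun s => ?_)
    have hbd : ∀ w ∈ unitDisk, ‖∑ i ∈ s, lp.single 2 i (g w i)‖ ≤ C := by
      intro w hw
      refine le_trans ?_ (hC w hw)
      have h2 : (0 : ℝ) < (2 : ℝ≥0∞).toReal := by norm_num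
      rw [← Real.rpow_le_rpow_iff (norm_nonneg _) (norm_nonneg _) h2,
        lp.norm_sum_single h2 (fun i => g w i) s]
      exact lp.sum_rpow_le_norm_rpow h2 (g w) s
    have hdiff : DifferentiableOn ℂ (fun w => ∑ i ∈ s, lp.single (E := fun _ : ι => E) 2 i (g w i))
        (ball c R) := by
      refine DifferentiableOn.fun_sum fun i _ => ?_
      exact (lp.singleContinuousLinearMap ℂ (fun _ : ι => E) 2
        i).differentiable.comp_differentiableOn ((hg i).mono hRD)
    refine Complex.dist_le_div_mul_dist_of_mapsTo_ball hdiff (fun w hw => ?_) hz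
    rw [mem_closedBall, dist_eq_norm]
    calc _ ≤ _ := norm_sub_le _ _
      _ ≤ 2 * C := by linarith [hbd w (hRD hw), hbd c hc]
  refine ContinuousAt.continuousWithinAt ?_
  rw [ContinuousAt, tendsto_iff_dist_tendsto_zero]
  refine squeeze_zero' (Filter.Eventually.of_forall fun _ => dist_nonneg)
    (Filter.eventually_of_mem (ball_mem_nhds c hR) hb) ?_
  have : Continuous fun z => (2 * C) / R * dist z c := by fun_prop
  simpa using this.tendsto c

/-- A bounded `ℓ²`-valued function with holomorphic coordinates is holomorphic: it is the Cauchy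
integral of its boundary values, because its coordinates are. -/
theorem differentiableOn_of_coord [CompleteSpace E] {g : ℂ → lp (fun _ : ι => E) 2} {C : ℝ}
    (hC : ∀ z ∈ unitDisk, ‖g z‖ ≤ C)
    (hg : ∀ i, DifferentiableOn ℂ (fun z => g z i) unitDisk) : DifferentiableOn ℂ g unitDisk := by
  have hcont := continuousOn_of_coord hC hg
  intro c hc
  obtain ⟨R, hR, hRD⟩ := Metric.isOpen_iff.1 isOpen_unitDisk c hc
  have hR2 : 0 < R / 2 := by positivity
  have hsub : closedBall c (R / 2) ⊆ unitDisk :=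
    (closedBall_subset_ball (by linarith)).trans hRD
  have hci : CircleIntegrable g c (R / 2) :=
    (hcont.mono (sphere_subset_closedBall.trans hsub)).circleIntegrable hR2.le
  lift R / 2 to NNReal using hR2.le with ρ hρ
  have hρ0 : 0 < ρ := by exact_mod_cast hR2
  have hps := hasFPowerSeriesOn_cauchy_integral hci hρ0
  have heq : ∀ w ∈ ball c (ρ : ℝ),
      (2 * Real.pi * Complex.I : ℂ)⁻¹ • (∮ u in C(c, ρ), (u - w)⁻¹ • g u) = g w := by
    intro w hw
    refine lp.ext (funext fun i => ?_)
    have hgi : DiffContOnCl ℂ (fun z => g z i) (ball c ρ) :=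
      ((hg i).mono (closure_ball_subset_closedBall.trans hsub)).diffContOnCl
    rw [← hgi.two_pi_i_inv_smul_circleIntegral_sub_inv_smul hw]
    have hci' : CircleIntegrable (fun u => (u - w)⁻¹ • g u) c ρ := by
      refine ContinuousOn.circleIntegrable NNReal.zero_le_coe ?_
      refine ContinuousOn.smul (ContinuousOn.inv₀ (f := fun u => u - w) (by fun_prop) fun u hu h0 => ?_)
        (hcont.mono (sphere_subset_closedBall.trans hsub))
      rw [sub_eq_zero] at h0
      rw [← h0, mem_ball, mem_sphere.1 hu] at hw
      exact lt_irrefl _ hw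
    let ev : lp (fun _ : ι => E) 2 →L[ℂ] E := lp.evalCLM ℂ (fun _ : ι => E) 2 i
    have hev : ∀ x, ev x = x i := fun x => rfl
    have hcomm : ev (∮ u in C(c, ρ), (u - w)⁻¹ • g u) = ∮ u in C(c, ρ), ev ((u - w)⁻¹ • g u) := by
      simp only [circleIntegral]
      refine (ContinuousLinearMap.intervalIntegral_comp_comm ev hci'.out).symm.trans ?_
      simp
    rw [lp.coeFn_smul, Pi.smul_apply, ← hev, hcomm]
    simp [hev]
  have h1 : DifferentiableAt ℂ
      (fun w => (2 * Real.pi * Complex.I : ℂ)⁻¹ • (∮ u in C(c, ρ), (u - w)⁻¹ • g u)) c :=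
    hps.differentiableOn.differentiableAt (by
      rw [Metric.eball_coe]; exact ball_mem_nhds c hρ0)
  refine (h1.congr_of_eventuallyEq ?_).differentiableWithinAt
  filter_upwards [ball_mem_nhds c hR2] with w hw
  exact (heq w hw).symm

end Coordinates

/-! ### Taylor coefficients and circle averages -/

section Taylor

variable {H : Type*} [NormedAddCommGroup H] [InnerProductSpace ℂ H] [CompleteSpace H]

theorem circleAverage_norm_add_smul_sq (a : H) {q : ℂ → H} (hq : Differentiable ℂ q) (ρ : ℝ) :
    Real.circleAverage (fun z => ‖a + z • q z‖ ^ 2) 0 ρ =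
      ‖a‖ ^ 2 + ρ ^ 2 * Real.circleAverage (fun z => ‖q z‖ ^ 2) 0 ρ := by
  -- the real-linear functional `2 Re ⟪a, ·⟫`
  let L : H →L[ℝ] ℝ := (2 : ℝ) • Complex.reCLM.comp ((innerSL ℂ a).restrictScalars ℝ)
  have hqc := hq.continuous
  have hzq : Differentiable ℂ fun z : ℂ => z • q z := differentiable_id.smul hq
  have hzqc := hzq.continuous
  have hmean : Real.circleAverage (fun z => z • q z) 0 ρ = 0 := by
    rw [DiffContOnCl.circleAverage hzq.diffContOnCl, zero_smul]
  have hL : Real.circleAverage (L ∘ fun z => z • q z) 0 ρ = 0 := by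
    rw [L.circleAverage_comp_comm hzqc.continuousOn.circleIntegrable', hmean, map_zero]
  have hcongr : Set.EqOn (fun z => ‖a + z • q z‖ ^ 2)
      (fun z => ‖a‖ ^ 2 + ((L ∘ fun z => z • q z) z + ρ ^ 2 * ‖q z‖ ^ 2)) (sphere 0 |ρ|) := by
    intro z hz
    have hz' : ‖z‖ ^ 2 = ρ ^ 2 := by rw [mem_sphere_zero_iff_norm.1 hz, sq_abs]
    have h := @norm_add_sq ℂ H _ _ _ a (z • q z)
    simp only [RCLike.re_to_complex, norm_smul, mul_pow, hz'] at h
    have hLz : L (z • q z) = 2 * (inner ℂ a (z • q z)).re := rfl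
    simp only [h, Function.comp_apply, hLz]
    ring
  have hi1 : CircleIntegrable (L ∘ fun z => z • q z) 0 ρ :=
    (L.continuous.comp hzqc).continuousOn.circleIntegrable'
  have hi2 : CircleIntegrable (fun z => ρ ^ 2 * ‖q z‖ ^ 2) 0 ρ :=
    (by fun_prop : Continuous fun z => ρ ^ 2 * ‖q z‖ ^ 2).continuousOn.circleIntegrable'
  have h1 := Real.circleAverage_fun_add
    (circleIntegrable_const (‖a‖ ^ 2) (0 : ℂ) ρ) (hi1.add hi2)
  have h2 := Real.circleAverage_add hi1 hi2
  have h3 : Real.circleAverage (fun z => ρ ^ 2 * ‖q z‖ ^ 2) 0 ρ =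
      ρ ^ 2 * Real.circleAverage (fun z => ‖q z‖ ^ 2) 0 ρ :=
    Real.circleAverage_fun_smul (a := ρ ^ 2) (f := fun z => ‖q z‖ ^ 2)
  rw [Real.circleAverage_congr_sphere hcongr]
  refine h1.trans ?_
  rw [Real.circleAverage_const, h2, h3, hL, zero_add]

/-- Parseval's identity for vector-valued polynomials. -/
theorem circleAverage_norm_polynomial_sq (N : ℕ) (a : ℕ → H) (ρ : ℝ) :
    Real.circleAverage (fun z => ‖∑ n ∈ Finset.range N, z ^ n • a n‖ ^ 2) 0 ρ =
      ∑ n ∈ Finset.range N, ρ ^ (2 * n) * ‖a n‖ ^ 2 := by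
  induction N generalizing a with
  | zero => simp [Real.circleAverage_const]
  | succ N ih =>
    have hq : Differentiable ℂ fun z : ℂ => ∑ n ∈ Finset.range N, z ^ n • a (n + 1) :=
      Differentiable.fun_sum fun i _ => (differentiable_id.pow i).smul_const _
    have h := circleAverage_norm_add_smul_sq (a 0) hq ρ
    rw [ih fun n => a (n + 1), Finset.mul_sum] at h
    refine Eq.trans ?_ (h.trans ?_)
    · congr 1
      funext z
      rw [Finset.sum_range_succ', add_comm, Finset.smul_sum]
      simp [pow_succ', mul_smul]
    · rw [Finset.sum_range_succ', add_comm]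
      simp only [mul_zero, pow_zero, one_mul]
      congr 1
      refine Finset.sum_congr rfl fun n _ => ?_
      ring

/-- The `n`-th Taylor coefficient at the origin. -/
noncomputable def taylorCoeff (g : ℂ → H) (n : ℕ) : H :=
  (n.factorial : ℂ)⁻¹ • iteratedDeriv n g 0

theorem hasSum_taylorCoeff {g : ℂ → H} (hg : DifferentiableOn ℂ g unitDisk) {z : ℂ}
    (hz : z ∈ unitDisk) : HasSum (fun n : ℕ => z ^ n • taylorCoeff g n) (g z) := by
  have h := Complex.hasSum_taylorSeries_on_ball (c := 0) (r := 1) hg hz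
  simp only [sub_zero] at h
  convert! h using 2 with n
  rw [taylorCoeff, smul_comm]

theorem hasSum_deriv_taylorCoeff {g : ℂ → H} (hg : DifferentiableOn ℂ g unitDisk) {z : ℂ}
    (hz : z ∈ unitDisk) :
    HasSum (fun n : ℕ => z ^ n • (((n : ℂ) + 1) • taylorCoeff g (n + 1))) (deriv g z) := by
  have h := hasSum_taylorCoeff (hg.deriv isOpen_unitDisk) hz
  convert! h using 3 with n
  rw [taylorCoeff, taylorCoeff, smul_smul, iteratedDeriv_succ']
  congr 1
  have : (n.factorial : ℂ) ≠ 0 := by exact_mod_cast n.factorial_ne_zero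
  have : (n : ℂ) + 1 ≠ 0 := by exact_mod_cast n.succ_ne_zero
  rw [Nat.factorial_succ]
  push_cast
  field_simp

theorem norm_taylorCoeff_le {g : ℂ → H} (hg : DifferentiableOn ℂ g unitDisk) {C : ℝ}
    (hC : ∀ z ∈ unitDisk, ‖g z‖ ≤ C) {R : ℝ} (hR : 0 < R) (hR1 : R < 1) (n : ℕ) :
    ‖taylorCoeff g n‖ ≤ C / R ^ n := by
  have hsub : closedBall (0 : ℂ) R ⊆ unitDisk := closedBall_subset_ball hR1
  have h := Complex.norm_iteratedDeriv_le_of_forall_mem_sphere_norm_le (c := 0) n hR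
    ((hg.mono (closure_ball_subset_closedBall.trans hsub)).diffContOnCl)
    (fun z hz => hC z (hsub (sphere_subset_closedBall hz)))
  rw [taylorCoeff, norm_smul, norm_inv, Complex.norm_natCast]
  have hn : (0 : ℝ) < n.factorial := by exact_mod_cast n.factorial_pos
  rw [inv_mul_le_iff₀ hn]
  calc _ ≤ _ := h
    _ = _ := by ring

/-- Bessel's inequality on a circle of radius `ρ < 1`: on that circle the Taylor polynomials are
bounded by `C` up to a geometrically small error, so Parseval's identity applies to them. -/
theorem sum_norm_taylorCoeff_sq_le_of_lt {g : ℂ → H} (hg : DifferentiableOn ℂ g unitDisk) {C : ℝ}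
    (hC : ∀ z ∈ unitDisk, ‖g z‖ ≤ C) {ρ : ℝ} (hρ : 0 < ρ) (hρ1 : ρ < 1) (N : ℕ) :
    ∑ n ∈ Finset.range N, ρ ^ (2 * n) * ‖taylorCoeff g n‖ ^ 2 ≤ C ^ 2 := by
  obtain ⟨R, hρR, hR1⟩ := exists_between hρ1
  have hR : 0 < R := hρ.trans hρR
  have hC0 : 0 ≤ C := (norm_nonneg _).trans (hC 0 (by simp [mem_unitDisk]))
  have hq1 : ρ / R < 1 := (div_lt_one hR).2 hρR
  have hlim : Filter.Tendsto (fun K : ℕ => (C + C * (ρ / R) ^ K / (1 - ρ / R)) ^ 2) Filter.atTop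
      (𝓝 (C ^ 2)) := by
    have h0 := tendsto_pow_atTop_nhds_zero_of_lt_one (by positivity : 0 ≤ ρ / R) hq1
    have := (((h0.const_mul C).div_const (1 - ρ / R)).const_add C).pow 2
    simpa using this
  refine ge_of_tendsto hlim (Filter.eventually_atTop.2 ⟨N, fun K hK => ?_⟩)
  calc ∑ n ∈ Finset.range N, ρ ^ (2 * n) * ‖taylorCoeff g n‖ ^ 2
      ≤ ∑ n ∈ Finset.range K, ρ ^ (2 * n) * ‖taylorCoeff g n‖ ^ 2 :=
        Finset.sum_le_sum_of_subset_of_nonneg (Finset.range_mono hK) fun _ _ _ => by positivity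
    _ = Real.circleAverage
        (fun z => ‖∑ n ∈ Finset.range K, z ^ n • taylorCoeff g n‖ ^ 2) 0 ρ :=
        (circleAverage_norm_polynomial_sq K _ ρ).symm
    _ ≤ _ := by
      refine Real.circleAverage_mono_on_of_le_circle
        (by fun_prop : Continuous _).continuousOn.circleIntegrable' fun z hz => ?_
      rw [mem_sphere_zero_iff_norm, abs_of_pos hρ] at hz
      have hzD : z ∈ unitDisk := mem_unitDisk.2 (hz ▸ hρ1)
      have hterm : ∀ n, ‖z ^ n • taylorCoeff g n‖ ≤ C * (ρ / R) ^ n := by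
        intro n
        rw [norm_smul, norm_pow, hz, div_pow]
        calc _ ≤ ρ ^ n * (C / R ^ n) := by
              gcongr; exact norm_taylorCoeff_le hg hC hR hR1 n
          _ = _ := by ring
      have h := norm_sub_le_of_geometric_bound_of_hasSum hq1 hterm (hasSum_taylorCoeff hg hzD) K
      gcongr
      calc _ ≤ _ := norm_le_norm_add_norm_sub' _ (g z)
        _ ≤ _ := add_le_add (hC z hzD) h

theorem sum_norm_taylorCoeff_sq_le {g : ℂ → H} (hg : DifferentiableOn ℂ g unitDisk) {C : ℝ}
    (hC : ∀ z ∈ unitDisk, ‖g z‖ ≤ C) (N : ℕ) :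
    ∑ n ∈ Finset.range N, ‖taylorCoeff g n‖ ^ 2 ≤ C ^ 2 := by
  have hcont : Continuous fun ρ : ℝ =>
      ∑ n ∈ Finset.range N, ρ ^ (2 * n) * ‖taylorCoeff g n‖ ^ 2 := by fun_prop
  have hlim : Filter.Tendsto (fun ρ : ℝ =>
      ∑ n ∈ Finset.range N, ρ ^ (2 * n) * ‖taylorCoeff g n‖ ^ 2) (𝓝[<] 1)
      (𝓝 (∑ n ∈ Finset.range N, ‖taylorCoeff g n‖ ^ 2)) := by
    have := hcont.tendsto 1
    simp only [one_pow, one_mul] at this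
    exact this.mono_left nhdsWithin_le_nhds
  refine le_of_tendsto hlim ?_
  filter_upwards [Ioo_mem_nhdsLT (zero_lt_one' ℝ)] with ρ hρ
  exact sum_norm_taylorCoeff_sq_le_of_lt hg hC hρ.1 hρ.2 N

end Taylor

/-! ### The Littlewood–Paley inequality -/

theorem lintegral_unitDisk_eq_circleAverage {f : ℂ → ℝ} (hf : Continuous f) (hf0 : ∀ z, 0 ≤ f z) :
    ∫⁻ z in unitDisk, ENNReal.ofReal (f z * (1 - ‖z‖ ^ 2)) =
      ∫⁻ ρ in Set.Ioo (0 : ℝ) 1,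
        ENNReal.ofReal (2 * Real.pi * (ρ * (1 - ρ ^ 2) * Real.circleAverage f 0 ρ)) := by
  have hpolar : ∀ ρ θ : ℝ, Complex.polarCoord.symm (ρ, θ) = circleMap 0 ρ θ := by
    intro ρ θ
    rw [Complex.polarCoord_symm_apply, circleMap, zero_add, Complex.exp_mul_I]
    simp
  have hmeas : Measurable fun z : ℂ =>
      (unitDisk.indicator (fun z => ENNReal.ofReal (f z * (1 - ‖z‖ ^ 2))) z) :=
    Measurable.indicator (by fun_prop) isOpen_unitDisk.measurableSet
  have hcm : Continuous fun p : ℝ × ℝ => circleMap 0 p.1 p.2 := by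
    simp only [circleMap]; fun_prop
  rw [← lintegral_indicator isOpen_unitDisk.measurableSet,
    ← Complex.lintegral_comp_polarCoord_symm, polarCoord_target, Measure.volume_eq_prod,
    ← Measure.prod_restrict, lintegral_prod]
  · rw [← lintegral_indicator measurableSet_Ioi, ← lintegral_indicator measurableSet_Ioo]
    refine lintegral_congr fun ρ => ?_
    by_cases h0 : 0 < ρ
    swap
    · rw [Set.indicator_of_notMem (by simpa using h0),
        Set.indicator_of_notMem fun h => h0 h.1]
    rw [Set.indicator_of_mem (by exact h0)]
    simp only [hpolar, smul_eq_mul]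
    by_cases h1 : ρ < 1
    swap
    · rw [Set.indicator_of_notMem fun h => h1 h.2]
      have : ∀ θ, circleMap 0 ρ θ ∉ unitDisk := fun θ => by
        simpa [mem_unitDisk, abs_of_pos h0] using h1
      simp [this]
    rw [Set.indicator_of_mem (by exact ⟨h0, h1⟩)]
    have hin : ∀ θ, circleMap 0 ρ θ ∈ unitDisk := fun θ => by
      simpa [mem_unitDisk, abs_of_pos h0] using h1
    have hw : 0 ≤ ρ * (1 - ρ ^ 2) := mul_nonneg h0.le (by nlinarith)
    have hfc : Continuous fun θ => f (circleMap 0 ρ θ) := by fun_prop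
    have hcalc : ∀ θ, ENNReal.ofReal ρ * unitDisk.indicator
        (fun z => ENNReal.ofReal (f z * (1 - ‖z‖ ^ 2))) (circleMap 0 ρ θ) =
        ENNReal.ofReal (ρ * (1 - ρ ^ 2)) * ENNReal.ofReal (f (circleMap 0 ρ θ)) := by
      intro θ
      rw [Set.indicator_of_mem (hin θ), ← ENNReal.ofReal_mul h0.le, ← ENNReal.ofReal_mul hw]
      congr 1
      simp
      ring
    simp only [hcalc]
    rw [lintegral_const_mul _ (by fun_prop), ← ofReal_integral_eq_lintegral_ofReal,
      ← ENNReal.ofReal_mul hw]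
    · congr 1
      have h2 : ∫ θ in Set.Ioo (-Real.pi) Real.pi, f (circleMap 0 ρ θ) =
          2 * Real.pi * Real.circleAverage f 0 ρ := by
        rw [Real.circleAverage_eq_integral_add (-Real.pi),
          intervalIntegral.integral_comp_add_right (fun θ => f (circleMap 0 ρ θ)),
          ← integral_Ioc_eq_integral_Ioo, ← intervalIntegral.integral_of_le
            (by linarith [Real.pi_pos])]
        rw [show 0 + -Real.pi = -Real.pi by ring, show 2 * Real.pi + -Real.pi = Real.pi by ring,
          smul_eq_mul, mul_inv_cancel_left₀ (by positivity)]
      rw [h2]; ring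
    · exact (hfc.integrableOn_Icc (a := -Real.pi) (b := Real.pi)).mono_set Set.Ioo_subset_Icc_self
    · exact Filter.Eventually.of_forall fun θ => hf0 _
  · refine Measurable.aemeasurable ?_
    refine Measurable.mul (by fun_prop) (hmeas.comp ?_)
    have : (Complex.polarCoord.symm : ℝ × ℝ → ℂ) = fun p => circleMap 0 p.1 p.2 :=
      funext fun p => hpolar p.1 p.2
    rw [this]
    exact hcm.measurable

theorem integral_radial_weight (n : ℕ) :
    ∫ ρ in (0 : ℝ)..1, ρ * (1 - ρ ^ 2) * ρ ^ (2 * n) = 1 / (2 * ((n : ℝ) + 1) * (n + 2)) := by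
  have h : ∀ ρ : ℝ, ρ * (1 - ρ ^ 2) * ρ ^ (2 * n) = ρ ^ (2 * n + 1) - ρ ^ (2 * n + 3) := by
    intro ρ; ring
  simp only [h]
  rw [intervalIntegral.integral_sub (by simp) (by simp), integral_pow, integral_pow]
  push_cast
  have : (n : ℝ) + 1 ≠ 0 := by positivity
  have : (n : ℝ) + 2 ≠ 0 := by positivity
  have : (2 * n : ℝ) + 1 + 1 ≠ 0 := by positivity
  have : (2 * n : ℝ) + 3 + 1 ≠ 0 := by positivity
  simp
  field_simp
  ring

section LittlewoodPaley

variable {H : Type*} [NormedAddCommGroup H] [InnerProductSpace ℂ H] [CompleteSpace H]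

/-- The weights `2 π (n + 1) ^ 2 ∫ ρ ^ (2 n + 1) (1 - ρ ^ 2) = π (n + 1) / (n + 2)` that Parseval's
identity produces are at most `π`. -/
theorem lintegral_norm_deriv_polynomial_sq_le (N : ℕ) (a : ℕ → H) :
    ∫⁻ z in unitDisk, ENNReal.ofReal
      (‖∑ n ∈ Finset.range N, z ^ n • (((n : ℂ) + 1) • a (n + 1))‖ ^ 2 * (1 - ‖z‖ ^ 2)) ≤
      ENNReal.ofReal (Real.pi * ∑ n ∈ Finset.range (N + 1), ‖a n‖ ^ 2) := by
  rw [lintegral_unitDisk_eq_circleAverage (by fun_prop) (fun z => by positivity)]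
  simp only [circleAverage_norm_polynomial_sq]
  rw [← ofReal_integral_eq_lintegral_ofReal]
  · refine ENNReal.ofReal_le_ofReal ?_
    rw [← integral_Ioc_eq_integral_Ioo, ← intervalIntegral.integral_of_le zero_le_one]
    have h : ∀ ρ : ℝ, 2 * Real.pi * (ρ * (1 - ρ ^ 2) *
        ∑ n ∈ Finset.range N, ρ ^ (2 * n) * ‖((n : ℂ) + 1) • a (n + 1)‖ ^ 2) =
        ∑ n ∈ Finset.range N, 2 * Real.pi * ((n : ℝ) + 1) ^ 2 * ‖a (n + 1)‖ ^ 2 *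
          (ρ * (1 - ρ ^ 2) * ρ ^ (2 * n)) := by
      intro ρ
      rw [Finset.mul_sum, Finset.mul_sum]
      refine Finset.sum_congr rfl fun n _ => ?_
      have : ‖(n : ℂ) + 1‖ = (n : ℝ) + 1 := by
        have := Complex.norm_natCast (n + 1)
        push_cast at this
        exact this
      rw [norm_smul, this]
      ring
    simp only [h]
    rw [intervalIntegral.integral_finsetSum fun n _ =>
      (by fun_prop : Continuous _).intervalIntegrable _ _]
    simp only [intervalIntegral.integral_const_mul, integral_radial_weight]
    rw [Finset.sum_range_succ', mul_add, Finset.mul_sum]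
    refine le_add_of_le_of_nonneg (Finset.sum_le_sum fun n _ => ?_)
      (mul_nonneg Real.pi_pos.le (by positivity))
    have hle : 2 * ((n : ℝ) + 1) ^ 2 * (1 / (2 * ((n : ℝ) + 1) * (n + 2))) ≤ 1 := by
      rw [mul_one_div, div_le_one (by positivity)]
      nlinarith [(Nat.cast_nonneg n : (0 : ℝ) ≤ n)]
    calc _ = Real.pi * ‖a (n + 1)‖ ^ 2 *
          (2 * ((n : ℝ) + 1) ^ 2 * (1 / (2 * ((n : ℝ) + 1) * (n + 2)))) := by ring
      _ ≤ Real.pi * ‖a (n + 1)‖ ^ 2 * 1 := by gcongr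
      _ = _ := by ring
  · exact ((by fun_prop : Continuous _).integrableOn_Icc (a := (0 : ℝ)) (b := 1)).mono_set
      Set.Ioo_subset_Icc_self
  · refine (ae_restrict_iff' measurableSet_Ioo).2 (Filter.Eventually.of_forall fun ρ hρ => ?_)
    have : 0 ≤ 1 - ρ ^ 2 := by nlinarith [hρ.1, hρ.2]
    have := hρ.1
    simp only [Pi.zero_apply]
    refine mul_nonneg (by positivity) (mul_nonneg (by positivity)
      (Finset.sum_nonneg fun n _ => by positivity))

/-- The Littlewood–Paley inequality. It holds for the Taylor polynomials by Parseval's identity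
and passes to the limit by Fatou's lemma. -/
theorem lintegral_norm_deriv_sq_le {g : ℂ → H} (hg : DifferentiableOn ℂ g unitDisk) {C : ℝ}
    (hC : ∀ z ∈ unitDisk, ‖g z‖ ≤ C) :
    ∫⁻ z in unitDisk, ENNReal.ofReal (‖deriv g z‖ ^ 2 * (1 - ‖z‖ ^ 2)) ≤
      ENNReal.ofReal (Real.pi * C ^ 2) := by
  let p : ℕ → ℂ → ℝ≥0∞ := fun N z => ENNReal.ofReal
    (‖∑ n ∈ Finset.range N, z ^ n • (((n : ℂ) + 1) • taylorCoeff g (n + 1))‖ ^ 2 * (1 - ‖z‖ ^ 2))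
  have hp : ∀ N, ∫⁻ z in unitDisk, p N z ≤ ENNReal.ofReal (Real.pi * C ^ 2) := fun N =>
    (lintegral_norm_deriv_polynomial_sq_le N _).trans (ENNReal.ofReal_le_ofReal
      (mul_le_mul_of_nonneg_left (sum_norm_taylorCoeff_sq_le hg hC _) Real.pi_pos.le))
  have hlim : ∀ z ∈ unitDisk, Filter.liminf (fun N => p N z) Filter.atTop =
      ENNReal.ofReal (‖deriv g z‖ ^ 2 * (1 - ‖z‖ ^ 2)) := fun z hz =>
    (ENNReal.tendsto_ofReal
      (((hasSum_deriv_taylorCoeff hg hz).tendsto_sum_nat.norm.pow 2).mul_const _)).liminf_eq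
  rw [← setLIntegral_congr_fun isOpen_unitDisk.measurableSet hlim]
  refine (lintegral_liminf_le fun N => by fun_prop).trans ?_
  exact Filter.liminf_le_of_le (by isBoundedDefault) fun b hb => by
    obtain ⟨N, hN⟩ := hb.exists
    exact hN.trans (hp N)

end LittlewoodPaley

/-! ### Disk automorphisms and the Carleson condition -/

/-- The involutive automorphism of the unit disk that exchanges `a` and `0`. -/
noncomputable def diskInvolution (a z : ℂ) : ℂ := (a - z) / (1 - conj a * z)

section DiskInvolution

variable {a z : ℂ}

theorem one_sub_conj_mul_ne_zero (ha : a ∈ unitDisk) (hz : z ∈ unitDisk) :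
    1 - conj a * z ≠ 0 := by
  rw [mem_unitDisk] at ha hz
  intro h
  have h1 : ‖conj a * z‖ = 1 := by rw [← sub_eq_zero.1 h, norm_one]
  rw [norm_mul, Complex.norm_conj] at h1
  nlinarith [norm_nonneg a, norm_nonneg z]

theorem one_sub_norm_diskInvolution_sq (ha : a ∈ unitDisk) (hz : z ∈ unitDisk) :
    1 - ‖diskInvolution a z‖ ^ 2 =
      (1 - ‖a‖ ^ 2) * (1 - ‖z‖ ^ 2) / ‖1 - conj a * z‖ ^ 2 := by
  have h0 : ‖1 - conj a * z‖ ^ 2 ≠ 0 := by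
    simpa using one_sub_conj_mul_ne_zero ha hz
  rw [diskInvolution, norm_div, div_pow, eq_div_iff h0, sub_mul, div_mul_cancel₀ _ h0]
  simp only [← Complex.normSq_eq_norm_sq, Complex.normSq_apply]
  simp
  ring

theorem diskInvolution_mem (ha : a ∈ unitDisk) (hz : z ∈ unitDisk) :
    diskInvolution a z ∈ unitDisk := by
  have h := one_sub_norm_diskInvolution_sq ha hz
  have hpos : 0 < 1 - ‖diskInvolution a z‖ ^ 2 := by
    rw [h]
    have := norm_pos_iff.2 (one_sub_conj_mul_ne_zero ha hz)
    rw [mem_unitDisk] at ha hz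
    have h1 : 0 < 1 - ‖a‖ ^ 2 := by nlinarith [norm_nonneg a]
    have h2 : 0 < 1 - ‖z‖ ^ 2 := by nlinarith [norm_nonneg z]
    positivity
  rw [mem_unitDisk]
  nlinarith [norm_nonneg (diskInvolution a z)]

theorem diskInvolution_diskInvolution (ha : a ∈ unitDisk) (hz : z ∈ unitDisk) :
    diskInvolution a (diskInvolution a z) = z := by
  have h0 := one_sub_conj_mul_ne_zero ha hz
  have h1 := one_sub_conj_mul_ne_zero ha (diskInvolution_mem ha hz)
  have hq : diskInvolution a z * (1 - conj a * z) = a - z := div_mul_cancel₀ _ h0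
  rw [diskInvolution, div_eq_iff h1]
  linear_combination -hq

theorem hasDerivAt_diskInvolution (ha : a ∈ unitDisk) (hz : z ∈ unitDisk) :
    HasDerivAt (diskInvolution a) (-(1 - conj a * a) / (1 - conj a * z) ^ 2) z := by
  have h0 := one_sub_conj_mul_ne_zero ha hz
  have h := ((hasDerivAt_id z).const_sub a).div
    (((hasDerivAt_id z).const_mul (conj a)).const_sub 1) h0
  refine h.congr_deriv ?_
  simp only [id]
  ring

theorem image_diskInvolution (ha : a ∈ unitDisk) : diskInvolution a '' unitDisk = unitDisk :=
  Set.Subset.antisymm (Set.image_subset_iff.2 fun _ hz => diskInvolution_mem ha hz)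
    fun _ hz => ⟨_, diskInvolution_mem ha hz, diskInvolution_diskInvolution ha hz⟩

theorem injOn_diskInvolution (ha : a ∈ unitDisk) : Set.InjOn (diskInvolution a) unitDisk :=
  fun _ hz _ hw h => by
    rw [← diskInvolution_diskInvolution ha hz, h, diskInvolution_diskInvolution ha hw]

end DiskInvolution

theorem abs_det_restrictScalars_toSpanSingleton (c : ℂ) :
    |(((ContinuousLinearMap.toSpanSingleton ℂ c).restrictScalars ℝ : ℂ →L[ℝ] ℂ)).det| =
      ‖c‖ ^ 2 := by
  have h : ((((ContinuousLinearMap.toSpanSingleton ℂ c).restrictScalars ℝ : ℂ →L[ℝ] ℂ)) :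
      ℂ →ₗ[ℝ] ℂ) = Algebra.lmul ℝ ℂ c := by
    ext
    simp [mul_comm]
  rw [ContinuousLinearMap.det, h, ← Algebra.norm_apply, Algebra.norm_complex_apply,
    Complex.normSq_eq_norm_sq, abs_of_nonneg (by positivity)]

section Carleson

variable {H : Type*} [NormedAddCommGroup H] [InnerProductSpace ℂ H] [CompleteSpace H]

/-- The Möbius invariant form of the Littlewood–Paley inequality. -/
theorem lintegral_norm_deriv_sq_diskInvolution_le {g : ℂ → H}
    (hg : DifferentiableOn ℂ g unitDisk) {C : ℝ} (hC : ∀ z ∈ unitDisk, ‖g z‖ ≤ C) {a : ℂ}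
    (ha : a ∈ unitDisk) :
    ∫⁻ z in unitDisk, ENNReal.ofReal (‖deriv g z‖ ^ 2 * (1 - ‖diskInvolution a z‖ ^ 2)) ≤
      ENNReal.ofReal (Real.pi * C ^ 2) := by
  have hmaps : Set.MapsTo (diskInvolution a) unitDisk unitDisk :=
    fun _ hz => diskInvolution_mem ha hz
  have hψ : DifferentiableOn ℂ (diskInvolution a) unitDisk := fun z hz =>
    (hasDerivAt_diskInvolution ha hz).differentiableAt.differentiableWithinAt
  refine le_of_eq_of_le ?_ (lintegral_norm_deriv_sq_le (g := g ∘ diskInvolution a)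
    (hg.comp hψ hmaps) (fun z hz => hC _ (hmaps hz)))
  conv_lhs => rw [← image_diskInvolution ha]
  rw [lintegral_image_eq_lintegral_abs_det_fderiv_mul volume isOpen_unitDisk.measurableSet
    (fun z hz => ((hasDerivAt_diskInvolution ha hz).hasFDerivAt.restrictScalars
      ℝ).hasFDerivWithinAt) (injOn_diskInvolution ha)]
  refine setLIntegral_congr_fun isOpen_unitDisk.measurableSet fun z hz => ?_
  have hd := hasDerivAt_diskInvolution ha hz
  have hgd : HasDerivAt g (deriv g (diskInvolution a z)) (diskInvolution a z) :=
    (hg.differentiableAt (isOpen_unitDisk.mem_nhds (hmaps hz))).hasDerivAt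
  have hcomp := (hgd.scomp z hd).deriv
  simp only [abs_det_restrictScalars_toSpanSingleton]
  rw [diskInvolution_diskInvolution ha hz, hcomp, norm_smul, mul_pow,
    ← ENNReal.ofReal_mul (by positivity), mul_assoc]

/-- The derivative of a bounded holomorphic function gives a Carleson measure. For a boundary
point `ζ` and `r < 1` the invariant inequality is used at `a = (1 - r) ζ`, whose kernel
`(1 - ‖a‖ ^ 2) / ‖1 - conj a * z‖ ^ 2` is at least `1 / (4 r)` on the disk of radius `r`
about `ζ`. -/
theorem setLIntegral_norm_deriv_sq_le {g : ℂ → H} (hg : DifferentiableOn ℂ g unitDisk) {C : ℝ}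
    (hC : ∀ z ∈ unitDisk, ‖g z‖ ≤ C) {ζ : ℂ} (hζ : ‖ζ‖ = 1) {r : ℝ} (hr : 0 < r) :
    ∫⁻ z in unitDisk ∩ ball ζ r, ENNReal.ofReal (‖deriv g z‖ ^ 2 * (1 - ‖z‖)) ≤
      ENNReal.ofReal (4 * Real.pi * C ^ 2 * r) := by
  have hmeas : MeasurableSet (unitDisk ∩ ball ζ r) :=
    isOpen_unitDisk.measurableSet.inter isOpen_ball.measurableSet
  rcases lt_or_ge r 1 with h1 | h1
  · have hna : ‖((1 - r : ℝ) : ℂ) * ζ‖ = 1 - r := by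
      rw [norm_mul, hζ, mul_one, Complex.norm_real, Real.norm_of_nonneg (by linarith)]
    set a : ℂ := ((1 - r : ℝ) : ℂ) * ζ with ha_def
    have ha : a ∈ unitDisk := by rw [mem_unitDisk, hna]; linarith
    have hpt : ∀ z ∈ unitDisk ∩ ball ζ r, ENNReal.ofReal (‖deriv g z‖ ^ 2 * (1 - ‖z‖)) ≤
        ENNReal.ofReal (4 * r) *
          ENNReal.ofReal (‖deriv g z‖ ^ 2 * (1 - ‖diskInvolution a z‖ ^ 2)) := by
      rintro z ⟨hz, hzr⟩
      rw [← ENNReal.ofReal_mul (by positivity)]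
      refine ENNReal.ofReal_le_ofReal ?_
      rw [one_sub_norm_diskInvolution_sq ha hz, hna]
      have hpos := norm_pos_iff.2 (one_sub_conj_mul_ne_zero ha hz)
      rw [mem_unitDisk] at hz
      have hle : ‖1 - conj a * z‖ ≤ 2 * r := by
        have hζζ : conj ζ * ζ = 1 := by
          rw [mul_comm, Complex.mul_conj, Complex.normSq_eq_norm_sq, hζ]; simp
        have h2 : 1 - conj a * z = conj ζ * ((ζ - z) + (r : ℂ) * z) := by
          rw [ha_def, map_mul, Complex.conj_ofReal]
          push_cast
          linear_combination -hζζ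
        rw [h2, norm_mul, Complex.norm_conj, hζ, one_mul]
        refine (norm_add_le _ _).trans ?_
        rw [norm_mul, Complex.norm_real, Real.norm_of_nonneg hr.le, ← dist_eq_norm, dist_comm]
        rw [mem_ball] at hzr
        nlinarith
      have hk : 1 - ‖z‖ ≤ 4 * r * ((1 - (1 - r) ^ 2) * (1 - ‖z‖ ^ 2) / ‖1 - conj a * z‖ ^ 2) := by
        rw [← mul_div_assoc, le_div_iff₀ (by positivity)]
        have hz0 := norm_nonneg z
        calc (1 - ‖z‖) * ‖1 - conj a * z‖ ^ 2 ≤ (1 - ‖z‖) * (2 * r) ^ 2 := by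
              have : 0 ≤ 1 - ‖z‖ := by linarith
              gcongr
          _ = 4 * r * (r * (1 - ‖z‖)) := by ring
          _ ≤ 4 * r * ((1 - (1 - r) ^ 2) * (1 - ‖z‖ ^ 2)) := by
              have h3 : r ≤ 1 - (1 - r) ^ 2 := by nlinarith
              have h4 : 1 - ‖z‖ ≤ 1 - ‖z‖ ^ 2 := by nlinarith
              have h5 : 0 ≤ 1 - ‖z‖ := by linarith
              have h6 : 0 ≤ 1 - (1 - r) ^ 2 := hr.le.trans h3
              gcongr
      calc _ ≤ ‖deriv g z‖ ^ 2 * _ := mul_le_mul_of_nonneg_left hk (by positivity)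
        _ = _ := by ring
    calc _ ≤ ∫⁻ z in unitDisk ∩ ball ζ r, ENNReal.ofReal (4 * r) *
          ENNReal.ofReal (‖deriv g z‖ ^ 2 * (1 - ‖diskInvolution a z‖ ^ 2)) :=
        setLIntegral_mono' hmeas hpt
      _ ≤ ∫⁻ z in unitDisk, ENNReal.ofReal (4 * r) *
          ENNReal.ofReal (‖deriv g z‖ ^ 2 * (1 - ‖diskInvolution a z‖ ^ 2)) :=
        lintegral_mono_set Set.inter_subset_left
      _ = ENNReal.ofReal (4 * r) * ∫⁻ z in unitDisk,
          ENNReal.ofReal (‖deriv g z‖ ^ 2 * (1 - ‖diskInvolution a z‖ ^ 2)) :=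
        lintegral_const_mul' _ _ ENNReal.ofReal_ne_top
      _ ≤ ENNReal.ofReal (4 * r) * ENNReal.ofReal (Real.pi * C ^ 2) := by
        gcongr
        exact lintegral_norm_deriv_sq_diskInvolution_le hg hC ha
      _ = _ := by
        rw [← ENNReal.ofReal_mul (by positivity)]
        congr 1
        ring
  · calc _ ≤ ∫⁻ z in unitDisk, ENNReal.ofReal (‖deriv g z‖ ^ 2 * (1 - ‖z‖)) :=
        lintegral_mono_set Set.inter_subset_left
      _ ≤ ∫⁻ z in unitDisk, ENNReal.ofReal (‖deriv g z‖ ^ 2 * (1 - ‖z‖ ^ 2)) := by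
        refine setLIntegral_mono' isOpen_unitDisk.measurableSet fun z hz => ?_
        rw [mem_unitDisk] at hz
        refine ENNReal.ofReal_le_ofReal (mul_le_mul_of_nonneg_left ?_ (by positivity))
        nlinarith [norm_nonneg z]
      _ ≤ ENNReal.ofReal (Real.pi * C ^ 2) := lintegral_norm_deriv_sq_le hg hC
      _ ≤ _ := by
        refine ENNReal.ofReal_le_ofReal ?_
        have : 0 ≤ Real.pi * C ^ 2 := by positivity
        nlinarith

end Carleson

/-! ### Operators that are bounded below off their kernels -/

section BoundedBelow

variable {E₁ E₂ : Type*} [NormedAddCommGroup E₁] [InnerProductSpace ℂ E₁]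
  [NormedAddCommGroup E₂] [InnerProductSpace ℂ E₂]

/-- The operator `A` is bounded below by `δ` on the orthogonal complement of its kernel: its nonzero
singular values are at least `δ`. -/
def BoundedBelow (δ : ℝ) (A : E₁ →L[ℂ] E₂) : Prop :=
  ∀ e ∈ (LinearMap.ker A.toLinearMap)ᗮ, δ * ‖e‖ ≤ ‖A e‖

theorem exists_mem_orthogonal_ker [CompleteSpace E₁] (A : E₁ →L[ℂ] E₂) (e : E₁) :
    ∃ n ∈ (LinearMap.ker A.toLinearMap)ᗮ, A n = A e := by
  have : CompleteSpace (LinearMap.ker A.toLinearMap) := A.isClosed_ker.completeSpace_coe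
  have hmem := (LinearMap.ker A.toLinearMap).starProjection_apply_mem e
  rw [LinearMap.mem_ker] at hmem
  refine ⟨e - (LinearMap.ker A.toLinearMap).starProjection e,
    Submodule.sub_starProjection_mem_orthogonal e, ?_⟩
  rw [map_sub]
  exact sub_eq_self.2 hmem

variable {δ : ℝ} {A B : E₁ →L[ℂ] E₂}

theorem BoundedBelow.eq_zero_of_norm_sub_lt (hA : BoundedBelow δ A) (hAB : ‖B - A‖ < δ) {e : E₁}
    (he : e ∈ (LinearMap.ker A.toLinearMap)ᗮ) (hBe : B e = 0) : e = 0 := by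
  by_contra h0
  have hpos := norm_pos_iff.2 h0
  have h1 := hA e he
  have h2 : ‖A e‖ ≤ ‖B - A‖ * ‖e‖ := by
    have := (B - A).le_opNorm e
    rwa [sub_apply, hBe, zero_sub, norm_neg] at this
  nlinarith

/-- The restriction of `B` to the orthogonal complement of the kernel of `A`, when `B` is close to
`A`, is injective. -/
theorem BoundedBelow.injective_comp_subtypeL (hA : BoundedBelow δ A) (hAB : ‖B - A‖ < δ) :
    Function.Injective (B ∘L (LinearMap.ker A.toLinearMap)ᗮ.subtypeL) := by
  refine (injective_iff_map_eq_zero _).2 fun e he => ?_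
  exact Subtype.ext (hA.eq_zero_of_norm_sub_lt hAB e.2 he)

theorem BoundedBelow.finiteDimensional_orthogonal_ker (hA : BoundedBelow δ A) (hδ : 0 < δ)
    [FiniteDimensional ℂ (LinearMap.range A.toLinearMap)] :
    FiniteDimensional ℂ (LinearMap.ker A.toLinearMap)ᗮ := by
  have hinj := hA.injective_comp_subtypeL (B := A) (by simpa using hδ)
  refine FiniteDimensional.of_injective
    ((A.toLinearMap ∘ₗ (LinearMap.ker A.toLinearMap)ᗮ.subtype).codRestrict
      (LinearMap.range A.toLinearMap) fun e => ⟨_, rfl⟩) fun x y hxy => hinj ?_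
  exact congrArg Subtype.val hxy

theorem range_comp_subtypeL_orthogonal_ker [CompleteSpace E₁] (A : E₁ →L[ℂ] E₂) :
    LinearMap.range (A ∘L (LinearMap.ker A.toLinearMap)ᗮ.subtypeL).toLinearMap =
      LinearMap.range A.toLinearMap := by
  refine le_antisymm ?_ ?_
  · rintro _ ⟨e, rfl⟩
    exact ⟨e, rfl⟩
  · rintro _ ⟨e, rfl⟩
    obtain ⟨n, hn, hne⟩ := exists_mem_orthogonal_ker A e
    exact ⟨⟨n, hn⟩, hne⟩

theorem BoundedBelow.finrank_range_eq_finrank_orthogonal_ker [CompleteSpace E₁]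
    (hA : BoundedBelow δ A)
    (hδ : 0 < δ) :
    Module.finrank ℂ (LinearMap.range A.toLinearMap) =
      Module.finrank ℂ (LinearMap.ker A.toLinearMap)ᗮ := by
  rw [← range_comp_subtypeL_orthogonal_ker A]
  exact LinearMap.finrank_range_of_inj (hA.injective_comp_subtypeL (by simpa using hδ))

theorem BoundedBelow.finrank_range_le [CompleteSpace E₁]
    (hA : BoundedBelow δ A) (hδ : 0 < δ) (hAB : ‖B - A‖ < δ)
    [FiniteDimensional ℂ (LinearMap.range B.toLinearMap)] :
    Module.finrank ℂ (LinearMap.range A.toLinearMap) ≤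
      Module.finrank ℂ (LinearMap.range B.toLinearMap) := by
  rw [hA.finrank_range_eq_finrank_orthogonal_ker hδ,
    ← LinearMap.finrank_range_of_inj (hA.injective_comp_subtypeL hAB)]
  refine Submodule.finrank_mono ?_
  rintro _ ⟨e, rfl⟩
  exact ⟨e, rfl⟩

/-- If `A` and `B` are both bounded below by `δ` and `‖B - A‖ < δ`, their ranks agree; hence `B`
already attains its range on the orthogonal complement of the kernel of `A`. -/
theorem BoundedBelow.range_comp_subtypeL [CompleteSpace E₁]
    (hA : BoundedBelow δ A) (hB : BoundedBelow δ B)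
    (hδ : 0 < δ) (hAB : ‖B - A‖ < δ) [FiniteDimensional ℂ (LinearMap.range A.toLinearMap)]
    [FiniteDimensional ℂ (LinearMap.range B.toLinearMap)] :
    LinearMap.range (B ∘L (LinearMap.ker A.toLinearMap)ᗮ.subtypeL).toLinearMap =
      LinearMap.range B.toLinearMap := by
  refine Submodule.eq_of_le_of_finrank_le ?_ ?_
  · rintro _ ⟨e, rfl⟩
    exact ⟨e, rfl⟩
  · have hinj := hA.injective_comp_subtypeL hAB
    rw [LinearMap.finrank_range_of_inj hinj,
      ← hA.finrank_range_eq_finrank_orthogonal_ker hδ]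
    exact hB.finrank_range_le hδ (by rwa [norm_sub_rev])

end BoundedBelow

section Adjoint

variable {E₁ E₂ : Type*} [NormedAddCommGroup E₁] [InnerProductSpace ℂ E₁]
  [NormedAddCommGroup E₂] [InnerProductSpace ℂ E₂] {δ : ℝ} {A : E₁ →L[ℂ] E₂}

theorem rangeProj_apply_apply [CompleteSpace E₂]
    (A : E₁ →L[ℂ] E₂) (e : E₁) : rangeProj A (A e) = A e :=
  Submodule.starProjection_eq_self_iff.2 (Submodule.le_topologicalClosure _ ⟨e, rfl⟩)

theorem apply_kerProj [CompleteSpace E₁] (A : E₁ →L[ℂ] E₂) (e : E₁) : A (kerProj A e) = 0 := by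
  have : kerProj A e ∈ LinearMap.range (kerProj A).toLinearMap := ⟨e, rfl⟩
  rwa [range_kerProj] at this

theorem kerProj_eq_one_sub_rangeProj_adjoint [CompleteSpace E₁] [CompleteSpace E₂]
    (A : E₁ →L[ℂ] E₂) :
    kerProj A = ContinuousLinearMap.id ℂ E₁ - rangeProj (ContinuousLinearMap.adjoint A) := by
  ext e
  refine Submodule.eq_starProjection_of_mem_orthogonal ?_ ?_
  · rw [A.isClosed_ker.submodule_topologicalClosure_eq]
    have h := (LinearMap.range (ContinuousLinearMap.adjoint
      A).toLinearMap).topologicalClosure.sub_starProjection_mem_orthogonal e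
    rwa [Submodule.orthogonal_closure, ContinuousLinearMap.orthogonal_range,
      ContinuousLinearMap.adjoint_adjoint] at h
  · rw [A.isClosed_ker.submodule_topologicalClosure_eq, A.orthogonal_ker]
    simp only [sub_apply, ContinuousLinearMap.id_apply, sub_sub_cancel]
    exact Submodule.starProjection_apply_mem _ _

theorem BoundedBelow.adjoint [CompleteSpace E₁] [CompleteSpace E₂]
    (hA : BoundedBelow δ A) (hδ : 0 < δ)
    [FiniteDimensional ℂ (LinearMap.range A.toLinearMap)] :
    BoundedBelow δ (ContinuousLinearMap.adjoint A) := by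
  intro y hy
  rw [(ContinuousLinearMap.adjoint A).orthogonal_ker, ContinuousLinearMap.adjoint_adjoint,
    (Submodule.closed_of_finiteDimensional _).submodule_topologicalClosure_eq] at hy
  obtain ⟨x, rfl⟩ := hy
  obtain ⟨n, hn, hnx⟩ := exists_mem_orthogonal_ker A x
  change δ * ‖A x‖ ≤ ‖ContinuousLinearMap.adjoint A (A x)‖
  rw [← hnx]
  rcases eq_or_ne (A n) 0 with h0 | h0
  · simp [h0]
  have h1 := hA n hn
  have h2 : ‖A n‖ ^ 2 ≤ ‖n‖ * ‖ContinuousLinearMap.adjoint A (A n)‖ := by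
    have h3 : (inner ℂ n (ContinuousLinearMap.adjoint A (A n))).re = ‖A n‖ ^ 2 := by
      rw [ContinuousLinearMap.adjoint_inner_right]
      exact inner_self_eq_norm_sq (𝕜 := ℂ) (A n)
    rw [← h3]
    exact (Complex.re_le_norm _).trans (norm_inner_le_norm _ _)
  have hpos := norm_pos_iff.2 h0
  refine le_of_mul_le_mul_right ?_ hpos
  nlinarith [norm_nonneg (ContinuousLinearMap.adjoint A (A n))]

theorem BoundedBelow.finiteDimensional_range_adjoint [CompleteSpace E₁] [CompleteSpace E₂]
    (hA : BoundedBelow δ A) (hδ : 0 < δ)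
    [FiniteDimensional ℂ (LinearMap.range A.toLinearMap)] :
    FiniteDimensional ℂ (LinearMap.range (ContinuousLinearMap.adjoint A).toLinearMap) := by
  have := hA.finiteDimensional_orthogonal_ker hδ
  refine Submodule.finiteDimensional_of_le (S₂ := (LinearMap.ker A.toLinearMap)ᗮ) ?_
  rw [A.orthogonal_ker]
  exact Submodule.le_topologicalClosure _

end Adjoint

/-! ### Smoothness of the range projection -/

section Smooth

variable {E₁ E₂ E₃ : Type*} [NormedAddCommGroup E₁] [InnerProductSpace ℂ E₁]
  [NormedAddCommGroup E₂] [InnerProductSpace ℂ E₂]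
  [NormedAddCommGroup E₃] [InnerProductSpace ℂ E₃]

/-- Composition of complex-linear operators as a real bilinear map. -/
noncomputable def compRealL (E₁ E₂ E₃ : Type*) [NormedAddCommGroup E₁] [InnerProductSpace ℂ E₁]
    [NormedAddCommGroup E₂] [InnerProductSpace ℂ E₂] [NormedAddCommGroup E₃]
    [InnerProductSpace ℂ E₃] :
    (E₂ →L[ℂ] E₃) →L[ℝ] (E₁ →L[ℂ] E₂) →L[ℝ] (E₁ →L[ℂ] E₃) :=
  (ContinuousLinearMap.compL ℂ E₁ E₂ E₃).bilinearRestrictScalars ℝ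

/-- The adjoint as a real-linear map. -/
noncomputable def adjointRealL (E₁ E₂ : Type*) [NormedAddCommGroup E₁] [InnerProductSpace ℂ E₁]
    [CompleteSpace E₁] [NormedAddCommGroup E₂] [InnerProductSpace ℂ E₂] [CompleteSpace E₂] :
    (E₁ →L[ℂ] E₂) →L[ℝ] (E₂ →L[ℂ] E₁) :=
  LinearMap.mkContinuous
    { toFun := fun A => ContinuousLinearMap.adjoint A
      map_add' := fun A B => map_add _ A B
      map_smul' := fun c A => by
        have h := (ContinuousLinearMap.adjoint (𝕜 := ℂ) (E := E₁) (F := E₂)).map_smulₛₗ (c : ℂ) A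
        simpa using h } 1 fun A => by simp

theorem contDiffAt_clm_comp {A : ℂ → E₂ →L[ℂ] E₃} {B : ℂ → E₁ →L[ℂ] E₂} {z : ℂ}
    (hA : ContDiffAt ℝ 2 A z) (hB : ContDiffAt ℝ 2 B z) :
    ContDiffAt ℝ 2 (fun w => A w ∘L B w) z :=
  (compRealL E₁ E₂ E₃).isBoundedBilinearMap.contDiff.contDiffAt.comp z (hA.prodMk hB)

theorem contDiffAt_adjoint [CompleteSpace E₁] [CompleteSpace E₂]
    {A : ℂ → E₁ →L[ℂ] E₂} {z : ℂ} (hA : ContDiffAt ℝ 2 A z) :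
    ContDiffAt ℝ 2 (fun w => ContinuousLinearMap.adjoint (A w)) z :=
  (adjointRealL E₁ E₂).contDiff.contDiffAt.comp z hA

theorem isUnit_adjoint_comp_self [CompleteSpace E₂]
    {N : Type*} [NormedAddCommGroup N] [InnerProductSpace ℂ N]
    [CompleteSpace N] [FiniteDimensional ℂ N] {B : N →L[ℂ] E₂} (hB : Function.Injective B) :
    IsUnit (ContinuousLinearMap.adjoint B ∘L B) := by
  have hinj : Function.Injective (ContinuousLinearMap.adjoint B ∘L B) := by
    refine (injective_iff_map_eq_zero _).2 fun x hx => hB ?_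
    rw [map_zero, ← inner_self_eq_zero (𝕜 := ℂ), ← ContinuousLinearMap.adjoint_inner_right]
    change inner ℂ x ((ContinuousLinearMap.adjoint B ∘L B) x) = 0
    rw [hx, inner_zero_right]
  rw [ContinuousLinearMap.isUnit_iff_bijective]
  exact ⟨hinj, LinearMap.injective_iff_surjective.1 hinj⟩

/-- The least-squares formula `B (B† B)⁻¹ B†` for the projection onto the range of an injective
operator `B`. -/
theorem rangeProj_eq_of_injective [CompleteSpace E₂]
    {N : Type*} [NormedAddCommGroup N] [InnerProductSpace ℂ N]
    [CompleteSpace N] [FiniteDimensional ℂ N] {B : N →L[ℂ] E₂} (hB : Function.Injective B) :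
    rangeProj B = B ∘L (Ring.inverse (ContinuousLinearMap.adjoint B ∘L B) ∘L
      ContinuousLinearMap.adjoint B) := by
  have hu := isUnit_adjoint_comp_self hB
  ext x
  refine Submodule.eq_starProjection_of_mem_orthogonal
    (Submodule.le_topologicalClosure _ ⟨_, rfl⟩) ?_
  rw [Submodule.orthogonal_closure, Submodule.mem_orthogonal]
  rintro _ ⟨n, rfl⟩
  have h := congrArg (fun T : N →L[ℂ] N => T (ContinuousLinearMap.adjoint B x))
    (Ring.mul_inverse_cancel _ hu)
  change ContinuousLinearMap.adjoint B (B (Ring.inverse (ContinuousLinearMap.adjoint B ∘L B)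
    (ContinuousLinearMap.adjoint B x))) = ContinuousLinearMap.adjoint B x at h
  change inner ℂ (B n) (x - B (Ring.inverse (ContinuousLinearMap.adjoint B ∘L B)
    (ContinuousLinearMap.adjoint B x))) = 0
  rw [← ContinuousLinearMap.adjoint_inner_right, map_sub, h, sub_self, inner_zero_right]

theorem rangeProj_congr [CompleteSpace E₂]
    {E₁' : Type*} [NormedAddCommGroup E₁'] [InnerProductSpace ℂ E₁']
    {A : E₁ →L[ℂ] E₂} {B : E₁' →L[ℂ] E₂}
    (h : LinearMap.range A.toLinearMap = LinearMap.range B.toLinearMap) :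
    rangeProj A = rangeProj B := by
  simp only [rangeProj, h]

/-- Near `c` the least-squares formula applies to the restriction of `T z` to the fixed
finite-dimensional space `(ker (T c))ᗮ`. -/
theorem contDiffOn_rangeProj [CompleteSpace E₁] [CompleteSpace E₂]
    {T : ℂ → E₁ →L[ℂ] E₂} (hT : ContDiffOn ℝ 2 T unitDisk) {δ : ℝ}
    (hδ : 0 < δ) (hbelow : ∀ z ∈ unitDisk, BoundedBelow δ (T z))
    (hfin : ∀ z ∈ unitDisk, FiniteDimensional ℂ (LinearMap.range (T z).toLinearMap)) :
    ContDiffOn ℝ 2 (fun z => rangeProj (T z)) unitDisk := by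
  intro c hc
  have hTc : ContDiffAt ℝ 2 T c := hT.contDiffAt (isOpen_unitDisk.mem_nhds hc)
  have := hfin c hc
  set N := (LinearMap.ker (T c).toLinearMap)ᗮ with hN
  have hNfin : FiniteDimensional ℂ N := (hbelow c hc).finiteDimensional_orthogonal_ker hδ
  have : CompleteSpace N := FiniteDimensional.complete ℂ N
  let B : ℂ → N →L[ℂ] E₂ := fun z => T z ∘L N.subtypeL
  have hB : ContDiffAt ℝ 2 B c := contDiffAt_clm_comp hTc contDiffAt_const
  have hBa := contDiffAt_adjoint hB
  have hnear : ∀ᶠ z in 𝓝 c, z ∈ unitDisk ∧ ‖T z - T c‖ < δ := by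
    refine Filter.Eventually.and (isOpen_unitDisk.mem_nhds hc) ?_
    have h := hTc.continuousAt.eventually (ball_mem_nhds (T c) hδ)
    filter_upwards [h] with z hz
    rwa [← dist_eq_norm]
  have hinjc : Function.Injective (B c) :=
    (hbelow c hc).injective_comp_subtypeL (by simpa using hδ)
  obtain ⟨u, hu⟩ := isUnit_adjoint_comp_self hinjc
  have hinv : ContDiffAt ℝ 2
      (fun z => Ring.inverse (ContinuousLinearMap.adjoint (B z) ∘L B z)) c := by
    have h := (contDiffAt_ringInverse ℂ (n := 2) u).restrict_scalars ℝ
    rw [hu] at h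
    exact h.comp c (contDiffAt_clm_comp hBa hB)
  have hP := contDiffAt_clm_comp hB (contDiffAt_clm_comp hinv hBa)
  refine (hP.congr_of_eventuallyEq ?_).contDiffWithinAt
  filter_upwards [hnear] with z hz
  have := hfin z hz.1
  rw [← rangeProj_eq_of_injective ((hbelow c hc).injective_comp_subtypeL hz.2)]
  exact rangeProj_congr
    ((hbelow c hc).range_comp_subtypeL (hbelow z hz.1) hδ hz.2).symm

theorem contDiffOn_kerProj [CompleteSpace E₁] [CompleteSpace E₂]
    {T : ℂ → E₁ →L[ℂ] E₂} (hT : ContDiffOn ℝ 2 T unitDisk) {δ : ℝ}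
    (hδ : 0 < δ) (hbelow : ∀ z ∈ unitDisk, BoundedBelow δ (T z))
    (hfin : ∀ z ∈ unitDisk, FiniteDimensional ℂ (LinearMap.range (T z).toLinearMap)) :
    ContDiffOn ℝ 2 (fun z => kerProj (T z)) unitDisk := by
  simp only [kerProj_eq_one_sub_rangeProj_adjoint]
  refine contDiffOn_const.sub (contDiffOn_rangeProj
    (fun z hz => (contDiffAt_adjoint (hT.contDiffAt (isOpen_unitDisk.mem_nhds
      hz))).contDiffWithinAt) hδ ?_ ?_)
  · intro z hz
    have := hfin z hz
    exact (hbelow z hz).adjoint hδ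
  · intro z hz
    have := hfin z hz
    exact (hbelow z hz).finiteDimensional_range_adjoint hδ

end Smooth

/-! ### Hilbert–Schmidt norms -/

section HilbertSchmidt

variable {E₁ E₂ ι : Type*} [NormedAddCommGroup E₁] [InnerProductSpace ℂ E₁]
  [NormedAddCommGroup E₂] [InnerProductSpace ℂ E₂]

theorem sum_norm_apply_sq_le [CompleteSpace E₁] [CompleteSpace E₂] (A : E₁ →L[ℂ] E₂)
    [FiniteDimensional ℂ (LinearMap.range A.toLinearMap)] {b : ι → E₁} (hb : Orthonormal ℂ b)
    (s : Finset ι) :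
    ∑ i ∈ s, ‖A (b i)‖ ^ 2 ≤ Module.finrank ℂ (LinearMap.range A.toLinearMap) * ‖A‖ ^ 2 := by
  let f := stdOrthonormalBasis ℂ (LinearMap.range A.toLinearMap)
  have h1 : ∀ i, ‖A (b i)‖ ^ 2 =
      ∑ j, ‖inner ℂ (b i) (ContinuousLinearMap.adjoint A (f j : E₂))‖ ^ 2 := by
    intro i
    have h := f.sum_sq_norm_inner_right ⟨A (b i), b i, rfl⟩
    rw [Submodule.coe_norm] at h
    rw [← h]
    refine Finset.sum_congr rfl fun j _ => ?_
    rw [ContinuousLinearMap.adjoint_inner_right, Submodule.coe_inner, norm_inner_symm]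
  simp only [h1]
  rw [Finset.sum_comm]
  calc _ ≤ ∑ j : Fin (Module.finrank ℂ (LinearMap.range A.toLinearMap)), ‖A‖ ^ 2 := by
        refine Finset.sum_le_sum fun j _ => (hb.sum_inner_products_le _).trans ?_
        have h2 := (ContinuousLinearMap.adjoint A).le_opNorm (f j : E₂)
        have h3 : ‖(f j : E₂)‖ = 1 := f.orthonormal.1 j
        rw [h3, mul_one, LinearIsometryEquiv.norm_map] at h2
        gcongr
    _ = _ := by simp

/-- The operator norm is at most the Hilbert–Schmidt norm. -/
theorem opNorm_le_norm_of_apply_eq {A : E₁ →L[ℂ] E₂} (b : HilbertBasis ι ℂ E₁)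
    (v : lp (fun _ : ι => E₂) 2) (hv : ∀ i, v i = A (b i)) : ‖A‖ ≤ ‖v‖ := by
  refine A.opNorm_le_bound (norm_nonneg v) fun x => ?_
  have h := ((b.hasSum_repr x).mapL A).norm
  refine le_of_tendsto h (Filter.Eventually.of_forall fun s => ?_)
  have hvs : ∑ i ∈ s, ‖v i‖ ^ 2 ≤ ‖v‖ ^ 2 := by
    have := lp.sum_rpow_le_norm_rpow (p := 2) (by norm_num) v s
    simpa using this
  have hxs : ∑ i ∈ s, ‖b.repr x i‖ ^ 2 ≤ ‖x‖ ^ 2 := by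
    simp only [b.repr_apply_apply]
    exact b.orthonormal.sum_inner_products_le x
  calc ‖∑ i ∈ s, A (b.repr x i • b i)‖ ≤ ∑ i ∈ s, ‖v i‖ * ‖b.repr x i‖ := by
        refine norm_sum_le_of_le s fun i _ => ?_
        rw [map_smul, norm_smul, hv, mul_comm]
    _ ≤ √(∑ i ∈ s, ‖v i‖ ^ 2) * √(∑ i ∈ s, ‖b.repr x i‖ ^ 2) := Real.sum_mul_le_sqrt_mul_sqrt _ _ _
    _ ≤ ‖v‖ * ‖x‖ := by
        gcongr
        · exact Real.sqrt_le_left (norm_nonneg _) |>.2 hvs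
        · exact Real.sqrt_le_left (norm_nonneg _) |>.2 hxs

end HilbertSchmidt

/-! ### The Hilbert–Schmidt lift of an operator-valued function -/

section Lift

variable {E₁ E₂ ι : Type*} [NormedAddCommGroup E₁] [InnerProductSpace ℂ E₁] [CompleteSpace E₁]
  [NormedAddCommGroup E₂] [InnerProductSpace ℂ E₂]

theorem finrank_range_eq_of_mem {T : ℂ → E₁ →L[ℂ] E₂} (hT : ContinuousOn T unitDisk) {δ : ℝ}
    (hδ : 0 < δ) (hbelow : ∀ z ∈ unitDisk, BoundedBelow δ (T z))
    (hfin : ∀ z ∈ unitDisk, FiniteDimensional ℂ (LinearMap.range (T z).toLinearMap)) {z w : ℂ}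
    (hz : z ∈ unitDisk) (hw : w ∈ unitDisk) :
    Module.finrank ℂ (LinearMap.range (T z).toLinearMap) =
      Module.finrank ℂ (LinearMap.range (T w).toLinearMap) := by
  have hconn : IsPreconnected unitDisk := (convex_ball (0 : ℂ) 1).isPreconnected
  refine hconn.constant (f := fun z => Module.finrank ℂ (LinearMap.range (T z).toLinearMap))
    (fun c hc => ?_) hz hw
  have hnear : ∀ᶠ z in 𝓝[unitDisk] c, ‖T z - T c‖ < δ := by
    filter_upwards [(hT c hc).eventually (ball_mem_nhds (T c) hδ)] with z hz
    rwa [← dist_eq_norm]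
  refine tendsto_nhds_of_eventually_eq ?_
  filter_upwards [hnear, self_mem_nhdsWithin] with z hz hzD
  have := hfin z hzD
  have := hfin c hc
  exact le_antisymm ((hbelow z hzD).finrank_range_le hδ (by rwa [norm_sub_rev]))
    ((hbelow c hc).finrank_range_le hδ hz)

/-- The function `z ↦ (F z (b i))ᵢ` is a bounded holomorphic function with values in an `ℓ²` sum: its
norm is the Hilbert–Schmidt norm of `F z`, which is bounded because the rank of `F z` does not depend
on `z`. -/
theorem exists_hilbertSchmidt_lift [CompleteSpace E₂] (b : HilbertBasis ι ℂ E₁)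
    {F : ℂ → E₁ →L[ℂ] E₂} (hF : IsHInfty F) {δ : ℝ} (hδ : 0 < δ)
    (hbelow : ∀ z ∈ unitDisk, BoundedBelow δ (F z))
    (hfin : ∀ z ∈ unitDisk, FiniteDimensional ℂ (LinearMap.range (F z).toLinearMap)) :
    ∃ g : ℂ → lp (fun _ : ι => E₂) 2, DifferentiableOn ℂ g unitDisk ∧
      (∃ C : ℝ, ∀ z ∈ unitDisk, ‖g z‖ ≤ C) ∧ ∀ z ∈ unitDisk, ‖deriv F z‖ ≤ ‖deriv g z‖ := by
  obtain ⟨hFd, M, hM⟩ := hF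
  have h0 : (0 : ℂ) ∈ unitDisk := by simp [mem_unitDisk]
  have hM0 : 0 ≤ M := (norm_nonneg _).trans (hM 0 h0)
  set r : ℕ := Module.finrank ℂ (LinearMap.range (F 0).toLinearMap) with hr
  have hsum : ∀ z ∈ unitDisk, ∀ s : Finset ι, ∑ i ∈ s, ‖F z (b i)‖ ^ (2 : ℝ≥0∞).toReal ≤
      (√r * M) ^ (2 : ℝ≥0∞).toReal := by
    intro z hz s
    have := hfin z hz
    have h := sum_norm_apply_sq_le (F z) b.orthonormal s
    rw [finrank_range_eq_of_mem hFd.continuousOn hδ hbelow hfin hz h0] at h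
    simp only [ENNReal.toReal_ofNat, Real.rpow_ofNat, mul_pow, Real.sq_sqrt (Nat.cast_nonneg r)]
    refine h.trans ?_
    gcongr
    exact hM z hz
  have hmem : ∀ z ∈ unitDisk, Memℓp (fun i => F z (b i)) 2 := fun z hz => memℓp_gen' (hsum z hz)
  classical
  let g : ℂ → lp (fun _ : ι => E₂) 2 := fun z =>
    if hz : z ∈ unitDisk then ⟨fun i => F z (b i), hmem z hz⟩ else 0
  have hg : ∀ z ∈ unitDisk, ∀ i, g z i = F z (b i) := fun z hz i => by simp only [g, dif_pos hz]
  have hgC : ∀ z ∈ unitDisk, ‖g z‖ ≤ √r * M := by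
    intro z hz
    refine lp.norm_le_of_forall_sum_le (by norm_num) (by positivity) fun s => ?_
    simp only [hg z hz]
    exact hsum z hz s
  have hgd : DifferentiableOn ℂ g unitDisk := by
    refine differentiableOn_of_coord hgC fun i => ?_
    refine DifferentiableOn.congr (f := fun z => F z (b i)) ?_ fun z hz => hg z hz i
    exact hFd.clm_apply (differentiableOn_const _)
  refine ⟨g, hgd, ⟨_, hgC⟩, fun z hz => opNorm_le_norm_of_apply_eq b (deriv g z) fun i => ?_⟩
  have hz' := isOpen_unitDisk.mem_nhds hz
  have h1 : HasDerivAt (fun w => g w i) (deriv g z i) z :=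
    (lp.evalCLM ℂ (fun _ : ι => E₂) 2 i).hasFDerivAt.comp_hasDerivAt z
      (hgd.differentiableAt hz').hasDerivAt
  have h2 : HasDerivAt (fun w => F w (b i)) (deriv F z (b i)) z := by
    simpa using (hFd.differentiableAt hz').hasDerivAt.clm_apply (hasDerivAt_const z (b i))
  refine h1.unique (h2.congr_of_eventuallyEq ?_)
  filter_upwards [hz'] with w hw
  exact hg w hw i

end Lift

/-! ### Consequences of a holomorphic majorant of the gradient -/

section Majorant

variable {H E : Type*} [NormedAddCommGroup H] [InnerProductSpace ℂ H]
  [NormedAddCommGroup E] [InnerProductSpace ℂ E] {P : ℂ → E →L[ℂ] E} {g : ℂ → H} {C : ℝ}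

theorem hasGradientBound_of_le (hg : DifferentiableOn ℂ g unitDisk)
    (hC : ∀ z ∈ unitDisk, ‖g z‖ ≤ C) (hP : ∀ z ∈ unitDisk, ‖dz P z‖ ≤ ‖deriv g z‖) :
    HasGradientBound P := by
  refine ⟨2 * C, fun z hz => (hP z hz).trans ?_⟩
  have hz1 := mem_unitDisk.1 hz
  have hsub : ball z (1 - ‖z‖) ⊆ unitDisk := by
    refine ball_subset_ball' ?_
    rw [dist_zero_right]
    linarith
  refine Complex.norm_deriv_le_div_of_mapsTo_ball (hg.mono hsub) (fun w hw => ?_) (by linarith)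
  rw [mem_closedBall, dist_eq_norm]
  calc _ ≤ _ := norm_sub_le _ _
    _ ≤ 2 * C := by linarith [hC w (hsub hw), hC z hz]

theorem hasCarlesonGradient_of_le [CompleteSpace H] (hg : DifferentiableOn ℂ g unitDisk)
    (hC : ∀ z ∈ unitDisk, ‖g z‖ ≤ C) (hP : ∀ z ∈ unitDisk, ‖dz P z‖ ≤ ‖deriv g z‖) :
    HasCarlesonGradient P := by
  refine ⟨4 * Real.pi * C ^ 2, fun ζ hζ r hr => ?_⟩
  have hmeas : MeasurableSet (unitDisk ∩ ball ζ r) :=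
    isOpen_unitDisk.measurableSet.inter isOpen_ball.measurableSet
  rw [withDensity_apply _ hmeas, Measure.restrict_restrict hmeas, Set.inter_right_comm,
    Set.inter_self]
  refine le_trans (setLIntegral_mono' hmeas fun z hz => ?_)
    (setLIntegral_norm_deriv_sq_le hg hC hζ hr)
  have h1 : 0 ≤ 1 - ‖z‖ := by linarith [mem_unitDisk.1 hz.1]
  have h2 := hP z hz.1
  gcongr

theorem hasBoundedPotential_of_le [CompleteSpace H] (hg : DifferentiableOn ℂ g unitDisk)
    (hC : ∀ z ∈ unitDisk, ‖g z‖ ≤ C) (hP : ∀ z ∈ unitDisk, ‖dz P z‖ ≤ ‖deriv g z‖) :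
    HasBoundedPotential P := by
  refine ⟨fun z => ‖g z‖ ^ 2, contDiffOn_norm_sq hg, isSubharmonicOnDisk_norm_sq hg,
    ⟨C ^ 2, fun z hz => ⟨by positivity,
      pow_le_pow_left₀ (norm_nonneg _) (hC z hz) 2⟩⟩, fun z hz => ?_⟩
  rw [normLaplacian_norm_sq hg hz]
  exact pow_le_pow_left₀ (norm_nonneg _) (hP z hz) 2

end Majorant

/-! ### Wirtinger derivatives of the projections -/

section Wirtinger

/-- The operator `∂̄ = (1/2) (∂/∂x + i ∂/∂y)`. -/
noncomputable def dzbar {V : Type*} [NormedAddCommGroup V] [NormedSpace ℂ V] (f : ℂ → V)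
    (z : ℂ) : V :=
  (1 / 2 : ℂ) • (fderiv ℝ f z 1 + Complex.I • fderiv ℝ f z Complex.I)

section General

variable {V : Type*} [NormedAddCommGroup V] [NormedSpace ℂ V] {f : ℂ → V} {z : ℂ}

theorem fderiv_real_apply (hf : DifferentiableAt ℂ f z) (v : ℂ) :
    fderiv ℝ f z v = v • deriv f z := by
  have h : HasFDerivAt f _ z := hf.hasDerivAt.hasFDerivAt.restrictScalars ℝ
  rw [h.fderiv]
  simp

theorem dz_eq_deriv (hf : DifferentiableAt ℂ f z) : dz f z = deriv f z := by
  rw [dz, fderiv_real_apply hf, fderiv_real_apply hf, smul_smul, Complex.I_mul_I]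
  module

theorem dzbar_eq_zero (hf : DifferentiableAt ℂ f z) : dzbar f z = 0 := by
  rw [dzbar, fderiv_real_apply hf, fderiv_real_apply hf, smul_smul, Complex.I_mul_I]
  module

end General

variable {E₁ E₂ E₃ : Type*} [NormedAddCommGroup E₁] [InnerProductSpace ℂ E₁]
  [NormedAddCommGroup E₂] [InnerProductSpace ℂ E₂]
  [NormedAddCommGroup E₃] [InnerProductSpace ℂ E₃] {z : ℂ}

theorem fderiv_comp_apply {A : ℂ → E₂ →L[ℂ] E₃} {B : ℂ → E₁ →L[ℂ] E₂}
    (hA : DifferentiableAt ℝ A z) (hB : DifferentiableAt ℝ B z) (v : ℂ) :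
    fderiv ℝ (fun w => A w ∘L B w) z v = fderiv ℝ A z v ∘L B z + A z ∘L fderiv ℝ B z v := by
  have h : HasFDerivAt (fun w => A w ∘L B w) _ z :=
    (compRealL E₁ E₂ E₃).hasFDerivAt_of_bilinear hA.hasFDerivAt hB.hasFDerivAt
  rw [h.fderiv, add_comm]
  rfl

theorem dz_comp {A : ℂ → E₂ →L[ℂ] E₃} {B : ℂ → E₁ →L[ℂ] E₂}
    (hA : DifferentiableAt ℝ A z) (hB : DifferentiableAt ℝ B z) :
    dz (fun w => A w ∘L B w) z = dz A z ∘L B z + A z ∘L dz B z := by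
  simp only [dz, fderiv_comp_apply hA hB]
  ext x
  simp
  module

theorem dzbar_comp {A : ℂ → E₂ →L[ℂ] E₃} {B : ℂ → E₁ →L[ℂ] E₂}
    (hA : DifferentiableAt ℝ A z) (hB : DifferentiableAt ℝ B z) :
    dzbar (fun w => A w ∘L B w) z = dzbar A z ∘L B z + A z ∘L dzbar B z := by
  simp only [dzbar, fderiv_comp_apply hA hB]
  ext x
  simp
  module

theorem adjoint_dz_of_isSelfAdjoint [CompleteSpace E₁] {P : ℂ → E₁ →L[ℂ] E₁}
    (hP : DifferentiableAt ℝ P z) (hsa : ∀ w, IsSelfAdjoint (P w)) :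
    ContinuousLinearMap.adjoint (dz P z) = dzbar P z := by
  have h : ∀ v, ContinuousLinearMap.adjoint (fderiv ℝ P z v) = fderiv ℝ P z v := by
    intro v
    have h1 : HasFDerivAt (fun w => ContinuousLinearMap.adjoint (P w)) _ z :=
      (adjointRealL E₁ E₁).hasFDerivAt.comp z hP.hasFDerivAt
    have h2 : (fun w => ContinuousLinearMap.adjoint (P w)) = P := funext fun w => hsa w
    rw [h2] at h1
    exact (congrArg (fun L => L v) h1.fderiv).symm
  rw [dz, dzbar, map_smulₛₗ, map_sub, map_smulₛₗ, h, h]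
  simp [map_ofNat]

theorem dz_eq_of_isIdempotentElem {P : ℂ → E₁ →L[ℂ] E₁} (hP : DifferentiableAt ℝ P z)
    (hid : ∀ w, P w ∘L P w = P w) : dz P z = dz P z ∘L P z + P z ∘L dz P z := by
  conv_lhs => rw [← funext hid]
  exact dz_comp hP hP

theorem isSelfAdjoint_rangeProj [CompleteSpace E₂] (A : E₁ →L[ℂ] E₂) :
    IsSelfAdjoint (rangeProj A) := isSelfAdjoint_starProjection _

theorem isSelfAdjoint_kerProj [CompleteSpace E₁] (A : E₁ →L[ℂ] E₂) :
    IsSelfAdjoint (kerProj A) := isSelfAdjoint_starProjection _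

theorem rangeProj_comp_self [CompleteSpace E₂] (A : E₁ →L[ℂ] E₂) :
    rangeProj A ∘L rangeProj A = rangeProj A := Submodule.isIdempotentElem_starProjection _

theorem kerProj_comp_self [CompleteSpace E₁] (A : E₁ →L[ℂ] E₂) :
    kerProj A ∘L kerProj A = kerProj A := Submodule.isIdempotentElem_starProjection _

theorem norm_rangeProj_apply_le [CompleteSpace E₂] (A : E₁ →L[ℂ] E₂) (x : E₂) :
    ‖rangeProj A x‖ ≤ ‖x‖ := Submodule.norm_starProjection_apply_le _ x

theorem norm_kerProj_apply_le [CompleteSpace E₁] (A : E₁ →L[ℂ] E₂) (x : E₁) :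
    ‖kerProj A x‖ ≤ ‖x‖ := Submodule.norm_starProjection_apply_le _ x

theorem norm_sub_rangeProj_apply_le [CompleteSpace E₂] (A : E₁ →L[ℂ] E₂) (x : E₂) :
    ‖x - rangeProj A x‖ ≤ ‖x‖ := by
  have h := (LinearMap.range A.toLinearMap).topologicalClosureᗮ.norm_starProjection_apply_le x
  rwa [Submodule.starProjection_orthogonal'] at h

variable {F : ℂ → E₁ →L[ℂ] E₂} {δ : ℝ}

/-- With `Π` the range projection, `Π F = F` gives `(∂̄Π) F = 0` and `(∂Π) F = (1 - Π) F'`. The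
former says that `Π ∂Π = 0`, so `∂Π = (∂Π) Π` is determined by the latter. -/
theorem norm_dz_rangeProj_le [CompleteSpace E₁] [CompleteSpace E₂]
    (hF : DifferentiableOn ℂ F unitDisk) (hδ : 0 < δ)
    (hP : DifferentiableOn ℝ (fun w => rangeProj (F w)) unitDisk) (hz : z ∈ unitDisk)
    (hbelow : BoundedBelow δ (F z))
    [FiniteDimensional ℂ (LinearMap.range (F z).toLinearMap)] :
    δ * ‖dz (fun w => rangeProj (F w)) z‖ ≤ ‖deriv F z‖ := by
  have hz' := isOpen_unitDisk.mem_nhds hz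
  have hFz := hF.differentiableAt hz'
  have hFr : DifferentiableAt ℝ F z := hFz.restrictScalars ℝ
  have hPz := hP.differentiableAt hz'
  have hPF : (fun w => rangeProj (F w) ∘L F w) = F := by
    funext w
    ext e
    exact rangeProj_apply_apply _ e
  have hdz := dz_comp hPz hFr
  rw [hPF, dz_eq_deriv hFz] at hdz
  have hdzbar := dzbar_comp hPz hFr
  rw [hPF, dzbar_eq_zero hFz, ContinuousLinearMap.comp_zero, add_zero,
    ← adjoint_dz_of_isSelfAdjoint hPz fun w => isSelfAdjoint_rangeProj _] at hdzbar
  have hid := dz_eq_of_isIdempotentElem hPz fun w => rangeProj_comp_self _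
  set D := dz (fun w => rangeProj (F w)) z with hD
  -- every vector of the range of `Π` is `F z n` with `δ ‖n‖` at most the norm of that vector
  have hlift : ∀ x, ∃ n, F z n = rangeProj (F z) x ∧ δ * ‖n‖ ≤ ‖x‖ := by
    intro x
    have hx : rangeProj (F z) x ∈ LinearMap.range (rangeProj (F z)).toLinearMap := ⟨x, rfl⟩
    rw [range_rangeProj] at hx
    obtain ⟨e, he⟩ := hx
    obtain ⟨n, hn, hne⟩ := exists_mem_orthogonal_ker (F z) e
    have hnx : F z n = rangeProj (F z) x := hne.trans he
    refine ⟨n, hnx, (hbelow n hn).trans ?_⟩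
    rw [hnx]
    exact norm_rangeProj_apply_le _ _
  have hzero : ∀ x, rangeProj (F z) (D x) = 0 := by
    intro x
    obtain ⟨n, hn, -⟩ := hlift (D x)
    rw [← inner_self_eq_zero (𝕜 := ℂ)]
    have h1 : inner ℂ (rangeProj (F z) (D x)) (rangeProj (F z) (D x)) =
        inner ℂ (D x) (rangeProj (F z) (D x)) := by
      have h := (isSelfAdjoint_rangeProj (F z)).isSymmetric (D x) (rangeProj (F z) (D x))
      refine h.trans ?_
      congr 1
      exact congrArg (fun T : E₂ →L[ℂ] E₂ => T (D x)) (rangeProj_comp_self (F z))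
    rw [h1, ← hn, ← ContinuousLinearMap.adjoint_inner_right]
    have h2 : ContinuousLinearMap.adjoint D (F z n) = 0 :=
      (congrArg (fun T : E₁ →L[ℂ] E₂ => T n) hdzbar).symm
    rw [h2, inner_zero_right]
  rw [← le_div_iff₀' hδ]
  refine D.opNorm_le_bound (by positivity) fun x => ?_
  obtain ⟨n, hn, hnx⟩ := hlift x
  have h1 : D x = D (F z n) := by
    rw [hn]
    have h := congrArg (fun T : E₂ →L[ℂ] E₂ => T x) hid
    exact h.trans (by simp [hzero])
  have h2 : D (F z n) = deriv F z n - rangeProj (F z) (deriv F z n) :=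
    eq_sub_of_add_eq (congrArg (fun T : E₁ →L[ℂ] E₂ => T n) hdz).symm
  rw [h1, h2, div_mul_eq_mul_div, le_div_iff₀ hδ]
  calc _ ≤ ‖deriv F z n‖ * δ := by gcongr; exact norm_sub_rangeProj_apply_le _ _
    _ ≤ ‖deriv F z‖ * ‖n‖ * δ := by gcongr; exact (deriv F z).le_opNorm n
    _ = ‖deriv F z‖ * (δ * ‖n‖) := by ring
    _ ≤ _ := by gcongr

/-- With `Π` the kernel projection, `F Π = 0` gives `F ∂̄Π = 0` and `F ∂Π = -F' Π`. The former says
that `(∂Π) Π = ∂Π`, so `Π ∂Π = 0` and `F` is bounded below on the range of `∂Π`. -/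
theorem norm_dz_kerProj_le [CompleteSpace E₁]
    (hF : DifferentiableOn ℂ F unitDisk) (hδ : 0 < δ)
    (hP : DifferentiableOn ℝ (fun w => kerProj (F w)) unitDisk) (hz : z ∈ unitDisk)
    (hbelow : BoundedBelow δ (F z)) :
    δ * ‖dz (fun w => kerProj (F w)) z‖ ≤ ‖deriv F z‖ := by
  have hz' := isOpen_unitDisk.mem_nhds hz
  have hFz := hF.differentiableAt hz'
  have hFr : DifferentiableAt ℝ F z := hFz.restrictScalars ℝ
  have hPz := hP.differentiableAt hz'
  have hFP : (fun w => F w ∘L kerProj (F w)) = fun _ => 0 := by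
    funext w
    ext e
    exact apply_kerProj _ e
  have hdz := dz_comp hFr hPz
  rw [hFP, dz_eq_deriv hFz, dz_eq_deriv (differentiableAt_const _), deriv_const] at hdz
  have hdzbar := dzbar_comp hFr hPz
  rw [hFP, dzbar_eq_zero hFz, dzbar_eq_zero (differentiableAt_const _),
    ContinuousLinearMap.zero_comp, zero_add,
    ← adjoint_dz_of_isSelfAdjoint hPz fun w => isSelfAdjoint_kerProj _] at hdzbar
  have hid := dz_eq_of_isIdempotentElem hPz fun w => kerProj_comp_self _
  set D := dz (fun w => kerProj (F w)) z with hD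
  have hfix : ∀ x, F z x = 0 → kerProj (F z) x = x := fun x hx =>
    Submodule.starProjection_eq_self_iff.2
      (Submodule.le_topologicalClosure _ (LinearMap.mem_ker.2 hx))
  have hsym := (isSelfAdjoint_kerProj (F z)).isSymmetric
  have hright : ∀ x, D (kerProj (F z) x) = D x := by
    intro x
    refine ext_inner_right ℂ fun y => ?_
    rw [← ContinuousLinearMap.adjoint_inner_right D, ← ContinuousLinearMap.adjoint_inner_right D]
    have h1 : F z (ContinuousLinearMap.adjoint D y) = 0 :=
      (congrArg (fun T : E₁ →L[ℂ] E₂ => T y) hdzbar).symm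
    have h2 := hsym x (ContinuousLinearMap.adjoint D y)
    refine h2.trans ?_
    congr 1
    exact hfix _ h1
  have hzero : ∀ x, kerProj (F z) (D x) = 0 := by
    intro x
    have h : D x = D (kerProj (F z) x) + kerProj (F z) (D x) :=
      congrArg (fun T : E₁ →L[ℂ] E₁ => T x) hid
    rw [hright] at h
    exact left_eq_add.1 h
  rw [← le_div_iff₀' hδ]
  refine D.opNorm_le_bound (by positivity) fun x => ?_
  have horth : D x ∈ (LinearMap.ker (F z).toLinearMap)ᗮ := by
    rw [Submodule.mem_orthogonal]
    intro u hu
    have h := hsym u (D x)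
    have h1 : kerProj (F z) u = u := hfix u hu
    change inner ℂ (kerProj (F z) u) (D x) = inner ℂ u (kerProj (F z) (D x)) at h
    rw [h1, hzero, inner_zero_right] at h
    exact h
  have h2 : F z (D x) = -deriv F z (kerProj (F z) x) := by
    have h : (0 : E₂) = deriv F z (kerProj (F z) x) + F z (D x) :=
      congrArg (fun T : E₁ →L[ℂ] E₂ => T x) hdz
    exact (neg_eq_of_add_eq_zero_right h.symm).symm
  rw [div_mul_eq_mul_div, le_div_iff₀' hδ]
  calc δ * ‖D x‖ ≤ ‖F z (D x)‖ := hbelow _ horth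
    _ = ‖deriv F z (kerProj (F z) x)‖ := by rw [h2, norm_neg]
    _ ≤ ‖deriv F z‖ * ‖kerProj (F z) x‖ := (deriv F z).le_opNorm _
    _ ≤ _ := by gcongr; exact norm_kerProj_apply_le _ _

end Wirtinger

end CoronaProj

theorem proposition3p1
    {E Es : Type*}
    [NormedAddCommGroup E] [InnerProductSpace ℂ E] [CompleteSpace E]
    [TopologicalSpace.SeparableSpace E]
    [NormedAddCommGroup Es] [InnerProductSpace ℂ Es] [CompleteSpace Es]
    [TopologicalSpace.SeparableSpace Es]
    (F : ℂ → Es →L[ℂ] E) (hF : CoronaProj.IsHInfty F)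
    (δ : ℝ) (hδ : 0 < δ)
    (hbelow : ∀ z ∈ CoronaProj.unitDisk, ∀ e ∈ (LinearMap.ker (F z).toLinearMap)ᗮ,
      δ * ‖e‖ ≤ ‖F z e‖)
    (hfin : ∀ z ∈ CoronaProj.unitDisk,
      FiniteDimensional ℂ (LinearMap.range (F z).toLinearMap)) :
    (ContDiffOn ℝ 2 (fun z => CoronaProj.rangeProj (F z)) CoronaProj.unitDisk ∧
      CoronaProj.HasGradientBound (fun z => CoronaProj.rangeProj (F z)) ∧
      CoronaProj.HasCarlesonGradient (fun z => CoronaProj.rangeProj (F z)) ∧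
      CoronaProj.HasBoundedPotential (fun z => CoronaProj.rangeProj (F z))) ∧
    (ContDiffOn ℝ 2 (fun z => CoronaProj.kerProj (F z)) CoronaProj.unitDisk ∧
      CoronaProj.HasGradientBound (fun z => CoronaProj.kerProj (F z)) ∧
      CoronaProj.HasCarlesonGradient (fun z => CoronaProj.kerProj (F z)) ∧
      CoronaProj.HasBoundedPotential (fun z => CoronaProj.kerProj (F z))) := by
  open CoronaProj in
  have hFr : ContDiffOn ℝ 2 F unitDisk :=
    (hF.1.contDiffOn isOpen_unitDisk).restrict_scalars ℝ
  have hR := contDiffOn_rangeProj hFr hδ hbelow hfin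
  have hK := contDiffOn_kerProj hFr hδ hbelow hfin
  obtain ⟨_, b, -⟩ := exists_hilbertBasis ℂ Es
  obtain ⟨g, hg, ⟨C, hC⟩, hFg⟩ := exists_hilbertSchmidt_lift b hF hδ hbelow hfin
  -- the factor `δ⁻¹` absorbs the constant in the bounds for `∂Π`
  have hg' : DifferentiableOn ℂ (fun z => (δ⁻¹ : ℂ) • g z) unitDisk := hg.fun_const_smul _
  have hnorm : ‖(δ⁻¹ : ℂ)‖ = δ⁻¹ := by
    rw [norm_inv, Complex.norm_real, Real.norm_of_nonneg hδ.le]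
  have hC' : ∀ z ∈ unitDisk, ‖(δ⁻¹ : ℂ) • g z‖ ≤ δ⁻¹ * C := fun z hz => by
    rw [norm_smul, hnorm]
    exact mul_le_mul_of_nonneg_left (hC z hz) (inv_nonneg.2 hδ.le)
  have hderiv : ∀ z ∈ unitDisk, ∀ t : ℝ, δ * t ≤ ‖deriv F z‖ →
      t ≤ ‖deriv (fun z => (δ⁻¹ : ℂ) • g z) z‖ := fun z hz t ht => by
    rw [deriv_fun_const_smul _ (hg.differentiableAt (isOpen_unitDisk.mem_nhds hz)), norm_smul,
      hnorm, le_inv_mul_iff₀ hδ]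
    exact ht.trans (hFg z hz)
  have hRz : ∀ z ∈ unitDisk, ‖dz (fun w => rangeProj (F w)) z‖ ≤ _ := fun z hz => by
    have := hfin z hz
    exact hderiv z hz _
      (norm_dz_rangeProj_le hF.1 hδ (hR.differentiableOn (by norm_num)) hz (hbelow z hz))
  have hKz : ∀ z ∈ unitDisk, ‖dz (fun w => kerProj (F w)) z‖ ≤ _ := fun z hz =>
    hderiv z hz _
      (norm_dz_kerProj_le hF.1 hδ (hK.differentiableOn (by norm_num)) hz (hbelow z hz))
  exact ⟨⟨hR, hasGradientBound_of_le hg' hC' hRz, hasCarlesonGradient_of_le hg' hC' hRz,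
    hasBoundedPotential_of_le hg' hC' hRz⟩, ⟨hK, hasGradientBound_of_le hg' hC' hKz,
    hasCarlesonGradient_of_le hg' hC' hKz, hasBoundedPotential_of_le hg' hC' hKz⟩⟩
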